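/- **Setting.** Fix an integer $k$ and a real $\alpha$, both independent of $n$, and put $m=\lfloor \alpha n\rfloor$. Let $\Phi_k(n,m)$ be the law of a random $k$-CNF formula $\Phi$ with $m$ ordered clauses, whose $km$ literals are i.i.d. uniform among the $2n$ literals over the variables $x_1,\dots,x_n$ (repetitions allowed). The factor graph $(G,\rho)$ of $\Phi$ is the bipartite multigraph with left vertices $\mathrm{Va}_G=\{v_1,\dots,v_n\}$, right vertices $\mathrm{Cl}_G=\{c_1,\dots,c_m\}$, and, for every $i\in[m]$ and $j\in[k]$, one edge joining $c_i$ to the variable of the $j$th literal of clause $i$, with polarity $\rho(e)=\mathtt T$ if that literal is positive and $\rho(e)=\mathtt F$ if it is negated. Write $V_G=\mathrm{Va}_G\cup \mathrm{Cl}_G$ and let $E_G$ be the set of edges. For $x,y\in\{\mathtt T,\mathtt F\}^n$ let $\Delta(x,y)=\frac1n|\{i:x_i\ne y_i\}|$. Let $(\Omega,\mathbb P_\omega)$ be a probability space. For a signed finite bipartite multigraph $(G,\rho)$, decorations $\varphi:V_G\cup E_G\to\Omega$, a memory map $\mu:V_G\to\mathbb Z_{\ge0}$ and a root $v\in V_G$,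 the neighborhood $N_r(v,G,\rho,\varphi)$ (respectively $N_r(v,G,\rho,\varphi,\mu)$) consists of the vertices and edges on paths of length at most $r$ from $v$, with root $v$ and the restrictions of $\rho,\varphi$ (and $\mu$). Isomorphisms preserve the root, the two sides, the incidences and all these labels. * An *$r$-local algorithm* is given by some $(\Omega,\mathbb P_\omega)$ and a measurable function $f$ with values in $\{\mathtt T,\mathtt F\}$ such that $f(v,G,\rho,\varphi)$ depends only on the isomorphism class of $N_r(v,G,\rho,\varphi)$. On input $\Phi$ with factor graph $(G,\rho)$ it samples $\varphi\sim\mathbb P_\omega^{\otimes (V_G\cup E_G)}$ independently of $\Phi$ and outputs $x\in\{\mathtt T,\mathtt F\}^n$ with $x_i=f(v_i,G,\rho,\varphi)$. * An *$r$-local memory algorithm* is given by some $(\Omega,\mathbb P_\omega)$, a function $f_2:\mathbb Z_{\ge0}\to\{\mathtt T,\mathtt F\}$ and a measurable $r$-local subroutine $f_1$. This means that $f_1$ maps $(v,G,\rho,\varphi,\mu)$ to a new memory map on $V_G$ that agrees with $\mu$ outside the $r$-neighborhood of $v$ and is determined on it by the isomorphism class of $N_r(v,G,\rho,\varphi,\mu)$,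 in the sense that every isomorphism between the $r$-neighborhoods of two inputs also matches the new memory contents. On input $\Phi$ the algorithm starts with $\mu\equiv0$, samples $\varphi\sim\mathbb P_\omega^{\otimes(V_G\cup E_G)}$ and $\psi\sim\mathrm{unif}([0,1])^{\otimes V_G}$, independently of each other and of $\Phi$, goes through all $v\in V_G$ (variables and clauses) in increasing order of $\psi(v)$, each time replacing $\mu$ by $f_1(v,G,\rho,\varphi,\mu)$, and finally outputs $x\in\{\mathtt T,\mathtt F\}^n$ with $x_i=f_2(\mu(v_i))$. **Proposition 7.1.** Suppose $\alpha k\ge 2$, $k-1\ge 2$, $\eta>0$ and $r\in\mathbb N=\{0,1,2,\dots\}$. There exist $R\in\mathbb N$, $c>0$ and $n_0\in\mathbb N$, depending only on $\alpha,k,r,\eta$, such that for every $r$-local memory algorithm $\mathcal A$ there is an $R$-local algorithm $\mathcal A'$ (not depending on $n$) with the following property. For all $n\ge n_0$ and $m=\lfloor\alpha n\rfloor$ there is a coupling of the internal randomnesses of $\mathcal A$ and $\mathcal A'$, independent of $\Phi$, such that $$\mathbb P\left[\Delta(\mathcal A(\Phi),\mathcal A'(\Phi))\ge\eta\right]\le\exp(-c\,n^{1/3}),$$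 where the probability is over $\Phi\sim\Phi_k(n,m)$ and the coupled randomnesses of $\mathcal A$ and $\mathcal A'$. -/

import Mathlib

open MeasureTheory

universe u

/-- A finite bipartite multigraph with left vertices `Va` (variables), right vertices `Cl` (clauses),
edges `E` (parallel edges are allowed), and a polarity `ρ` on the edges (`true` is `T`). -/
structure SignedGraph where
  Va : Type
  Cl : Type
  E : Type
  [finVa : Finite Va]
  [finCl : Finite Cl]
  [finE : Finite E]
  /-- the left endpoint of an edge -/
  va : E → Va
  /-- the right endpoint of an edge -/
  cl : E → Cl
  ρ : E → Bool

attribute [instance] SignedGraph.finVa SignedGraph.finCl SignedGraph.finE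

namespace SignedGraph

/-- All vertices, variables and clauses. -/
abbrev V (G : SignedGraph) : Type := G.Va ⊕ G.Cl

/-- All vertices and edges: the index set of the decorations. -/
abbrev Site (G : SignedGraph) : Type := G.V ⊕ G.E

/-- The underlying simple graph (it forgets multiplicities and signs). -/
def skeleton (G : SignedGraph) : SimpleGraph G.V :=
  SimpleGraph.fromRel fun x y => ∃ e, x = Sum.inl (G.va e) ∧ y = Sum.inr (G.cl e)

/-- The vertices reachable from `v` along a path of length at most `r`. -/
def ball (G : SignedGraph) (r : ℕ) (v : G.V) : Set G.V :=
  {u | ∃ p : G.skeleton.Walk v u, p.length ≤ r}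

theorem mem_ball_self (G : SignedGraph) (r : ℕ) (v : G.V) : v ∈ G.ball r v :=
  ⟨SimpleGraph.Walk.nil, Nat.zero_le r⟩

theorem skeleton_adj (G : SignedGraph) (e : G.E) :
    G.skeleton.Adj (Sum.inl (G.va e)) (Sum.inr (G.cl e)) := by
  refine (SimpleGraph.fromRel_adj _ _ _).2 ⟨by simp, Or.inl ⟨e, rfl, rfl⟩⟩

/-- The edges lying on paths of length at most `r` that start at `v` are exactly the edges with both
endpoints reachable by such paths (because the graph is bipartite). This is why the edge set of
`nbhd` below is given by the second description. -/
theorem edge_mem_ball_iff (G : SignedGraph) (r : ℕ) (v : G.V) (e : G.E) :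
    (Sum.inl (G.va e) ∈ G.ball r v ∧ Sum.inr (G.cl e) ∈ G.ball r v) ↔
      ∃ (u : G.V) (p : G.skeleton.Walk v u),
        p.length ≤ r ∧ s(Sum.inl (G.va e), Sum.inr (G.cl e)) ∈ p.edges := by
  classical
  constructor
  · rintro ⟨⟨p, hp⟩, ⟨q, hq⟩⟩
    let C : G.skeleton.Coloring Bool := SimpleGraph.Coloring.mk (fun x => x.isLeft) (by
      intro x y hxy
      rcases (SimpleGraph.fromRel_adj _ _ _).1 hxy with ⟨-, ⟨e, rfl, rfl⟩ | ⟨e, rfl, rfl⟩⟩ <;> simp)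
    have hpe := C.even_length_iff_congr p
    have hqe := C.even_length_iff_congr q
    have h1 : C (Sum.inl (G.va e)) = true := rfl
    have h2 : C (Sum.inr (G.cl e)) = false := rfl
    rw [h1] at hpe
    rw [h2] at hqe
    have hne : p.length ≠ q.length := by
      intro h
      rw [h] at hpe
      have := hpe.symm.trans hqe
      revert this
      cases C v <;> simp
    rcases lt_or_ge p.length r with h | h
    · exact ⟨_, p.concat (G.skeleton_adj e), by simp [SimpleGraph.Walk.length_concat]; omega,
        by simp [SimpleGraph.Walk.edges_concat]⟩
    · exact ⟨_, q.concat (G.skeleton_adj e).symm, by simp [SimpleGraph.Walk.length_concat]; omega,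
        by simp [SimpleGraph.Walk.edges_concat, Sym2.eq_swap]⟩
  · rintro ⟨u, p, hp, he⟩
    have h1 := p.fst_mem_support_of_mem_edges he
    have h2 := p.snd_mem_support_of_mem_edges he
    exact ⟨⟨p.takeUntil _ h1, (p.length_takeUntil_le_length h1).trans hp⟩,
      ⟨p.takeUntil _ h2, (p.length_takeUntil_le_length h2).trans hp⟩⟩

/-- The `r`-neighbourhood of `v`, as a signed graph. -/
def nbhd (G : SignedGraph) (r : ℕ) (v : G.V) : SignedGraph where
  Va := {a : G.Va // Sum.inl a ∈ G.ball r v}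
  Cl := {c : G.Cl // Sum.inr c ∈ G.ball r v}
  E := {e : G.E // Sum.inl (G.va e) ∈ G.ball r v ∧ Sum.inr (G.cl e) ∈ G.ball r v}
  va := fun e => ⟨G.va e.1, e.2.1⟩
  cl := fun e => ⟨G.cl e.1, e.2.2⟩
  ρ := fun e => G.ρ e.1

/-- The inclusion of the vertices of a neighbourhood. -/
def nbhdV (G : SignedGraph) (r : ℕ) (v : G.V) : (G.nbhd r v).V → G.V :=
  Sum.map Subtype.val Subtype.val

/-- The inclusion of the vertices and edges of a neighbourhood. -/
def nbhdSite (G : SignedGraph) (r : ℕ) (v : G.V) : (G.nbhd r v).Site → G.Site :=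
  Sum.map (G.nbhdV r v) Subtype.val

/-- The centre of a neighbourhood, as a vertex of it. -/
def nbhdRoot (G : SignedGraph) (r : ℕ) : (v : G.V) → (G.nbhd r v).V
  | Sum.inl a => Sum.inl ⟨a, G.mem_ball_self r _⟩
  | Sum.inr c => Sum.inr ⟨c, G.mem_ball_self r _⟩

/-- An isomorphism of signed bipartite multigraphs. -/
structure Iso (G H : SignedGraph) where
  onVa : G.Va ≃ H.Va
  onCl : G.Cl ≃ H.Cl
  onE : G.E ≃ H.E
  map_va : ∀ e, H.va (onE e) = onVa (G.va e)
  map_cl : ∀ e, H.cl (onE e) = onCl (G.cl e)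
  map_ρ : ∀ e, H.ρ (onE e) = G.ρ e

/-- The bijection of the vertices. -/
def Iso.onV {G H : SignedGraph} (i : Iso G H) : G.V ≃ H.V := Equiv.sumCongr i.onVa i.onCl

/-- The bijection of the vertices and edges. -/
def Iso.onSite {G H : SignedGraph} (i : Iso G H) : G.Site ≃ H.Site := Equiv.sumCongr i.onV i.onE

end SignedGraph

/-- Rooted decorated bipartite graphs `(v, G, ρ, φ)`, with decorations in `Ω`. -/
structure RootedGraph (Ω : Type u) where
  G : SignedGraph
  root : G.V
  φ : G.Site → Ω

namespace RootedGraph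

variable {Ω : Type u}

/-- The `r`-neighbourhood of the root, with the restricted decorations. -/
abbrev nbhd (x : RootedGraph Ω) (r : ℕ) : RootedGraph Ω where
  G := x.G.nbhd r x.root
  root := x.G.nbhdRoot r x.root
  φ := x.φ ∘ x.G.nbhdSite r x.root

/-- An isomorphism of rooted decorated bipartite graphs. -/
structure Iso (x y : RootedGraph Ω) extends toGraphIso : SignedGraph.Iso x.G y.G where
  map_root : toGraphIso.onV x.root = y.root
  map_φ : ∀ s, y.φ (toGraphIso.onSite s) = x.φ s

end RootedGraph

/-- A function on rooted decorated graphs is `r`-local if its value depends only on the isomorphism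
class of the `r`-neighbourhood of the root. -/
def IsLocalFunction {Ω : Type u} {β : Type*} (r : ℕ) (f : RootedGraph Ω → β) : Prop :=
  ∀ x y : RootedGraph Ω, Nonempty (RootedGraph.Iso (x.nbhd r) (y.nbhd r)) → f x = f y

/-- Rooted memory-augmented decorated bipartite graphs `(v, G, ρ, φ, μ)`. -/
structure MemoryGraph (Ω : Type u) extends RootedGraph Ω where
  μ : G.V → ℕ

namespace MemoryGraph

variable {Ω : Type u}

/-- The `r`-neighbourhood of the root, with the restricted decorations and memory. -/
abbrev nbhd (x : MemoryGraph Ω) (r : ℕ) : MemoryGraph Ω where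
  toRootedGraph := x.toRootedGraph.nbhd r
  μ := x.μ ∘ x.G.nbhdV r x.root

/-- An isomorphism of rooted memory-augmented decorated bipartite graphs. -/
structure Iso (x y : MemoryGraph Ω)
    extends toRootedIso : RootedGraph.Iso x.toRootedGraph y.toRootedGraph where
  map_μ : ∀ u, y.μ (toRootedIso.onV u) = x.μ u

end MemoryGraph

/-- An `r`-local subroutine sends `(v, G, ρ, φ, μ)` to the updated memory map on `G`. It edits only
the memory of the vertices in the `r`-neighbourhood of the root, and what it writes there is
determined by the isomorphism class of that neighbourhood: every isomorphism between the
neighbourhoods of two inputs also matches the new contents of the memory. -/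
structure IsLocalSubroutine {Ω : Type u} (r : ℕ)
    (f : (x : MemoryGraph Ω) → (x.G.V → ℕ)) : Prop where
  eq_outside : ∀ (x : MemoryGraph Ω) (u : x.G.V), u ∉ x.G.ball r x.root → f x u = x.μ u
  equivariant : ∀ (x y : MemoryGraph Ω) (i : MemoryGraph.Iso (x.nbhd r) (y.nbhd r))
    (u : (x.nbhd r).G.V),
    f y (y.G.nbhdV r y.root (i.onV u)) = f x (x.G.nbhdV r x.root u)

/-- `k`-CNF formulas with `m` ordered clauses over the variables `Fin n`; the literal `(j, true)` is
the variable `j` and `(j, false)` is its negation. -/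
abbrev Formula (k n m : ℕ) : Type := Fin m → Fin k → Fin n × Bool

/-- The random `k`-SAT distribution. -/
noncomputable def randomKSAT (k n m : ℕ) : Measure (Formula k n m) :=
  ProbabilityTheory.uniformOn Set.univ

/-- The vertices of the factor graph: `n` variables and `m` clauses. -/
abbrev FVertex (n m : ℕ) : Type := Fin n ⊕ Fin m

/-- The vertices and edges of the factor graph. There is one edge for each of the `k` literal
positions of each clause. -/
abbrev FSite (k n m : ℕ) : Type := FVertex n m ⊕ (Fin m × Fin k)

/-- The factor graph of a formula. -/
abbrev factorGraph {k n m : ℕ} (Φ : Formula k n m) : SignedGraph where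
  Va := Fin n
  Cl := Fin m
  E := Fin m × Fin k
  va := fun e => (Φ e.1 e.2).1
  cl := fun e => e.1
  ρ := fun e => (Φ e.1 e.2).2

/-- An `r`-local algorithm: a probability space for the decorations, and a (measurable) `r`-local
function with values in `{T, F}`. -/
structure LocalAlgorithm (r : ℕ) where
  Ω : Type u
  [mΩ : MeasurableSpace Ω]
  P : Measure Ω
  [isProb : IsProbabilityMeasure P]
  f : RootedGraph Ω → Bool
  isLocal : IsLocalFunction r f
  measurable_f : ∀ (G : SignedGraph) (v : G.V), Measurable fun φ : G.Site → Ω => f ⟨G, v, φ⟩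

attribute [instance] LocalAlgorithm.mΩ LocalAlgorithm.isProb

namespace LocalAlgorithm

variable {r : ℕ}

/-- The values of the internal randomness on inputs with `n` variables and `m` clauses. -/
abbrev Seed (A : LocalAlgorithm.{u} r) (k n m : ℕ) : Type u := FSite k n m → A.Ω

/-- The law of the internal randomness: i.i.d. decorations. -/
noncomputable def seedLaw (A : LocalAlgorithm.{u} r) (k n m : ℕ) : Measure (A.Seed k n m) :=
  Measure.pi fun _ => A.P

/-- The output. -/
def run (A : LocalAlgorithm.{u} r) {k n m : ℕ} (Φ : Formula k n m) (φ : A.Seed k n m) :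
    Fin n → Bool :=
  fun i => A.f ⟨factorGraph Φ, Sum.inl i, φ⟩

end LocalAlgorithm

/-- The vertices of the factor graph, listed in increasing order of `ψ`. (Ties, which have
probability zero, are broken by the fixed enumeration `v₁, …, vₙ, c₁, …, cₘ`.) -/
noncomputable def processingOrder {n m : ℕ} (ψ : FVertex n m → unitInterval) :
    List (FVertex n m) :=
  ((List.finRange n).map Sum.inl ++ (List.finRange m).map Sum.inr).insertionSort
    fun x y => ψ x ≤ ψ y

/-- An `r`-local memory algorithm: a probability space for the decorations, a (measurable) `r`-local
subroutine `f₁`, and a final decision function `f₂`. -/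
structure LocalMemoryAlgorithm (r : ℕ) where
  Ω : Type u
  [mΩ : MeasurableSpace Ω]
  P : Measure Ω
  [isProb : IsProbabilityMeasure P]
  f₁ : (x : MemoryGraph Ω) → (x.G.V → ℕ)
  isLocal : IsLocalSubroutine r f₁
  measurable_f₁ : ∀ (G : SignedGraph) (v : G.V) (μ : G.V → ℕ) (u : G.V),
    Measurable fun φ : G.Site → Ω => f₁ ⟨⟨G, v, φ⟩, μ⟩ u
  f₂ : ℕ → Bool

attribute [instance] LocalMemoryAlgorithm.mΩ LocalMemoryAlgorithm.isProb

namespace LocalMemoryAlgorithm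

variable {r : ℕ}

/-- The values of the internal randomness `(φ, ψ)` on inputs with `n` variables and `m` clauses. -/
abbrev Seed (A : LocalMemoryAlgorithm.{u} r) (k n m : ℕ) : Type u :=
  (FSite k n m → A.Ω) × (FVertex n m → unitInterval)

/-- The law of the internal randomness: i.i.d. decorations `φ` and, independently, i.i.d. uniform
`ψ`. -/
noncomputable def seedLaw (A : LocalMemoryAlgorithm.{u} r) (k n m : ℕ) : Measure (A.Seed k n m) :=
  (Measure.pi fun _ => A.P).prod (Measure.pi fun _ => volume)

/-- The memory after all vertices have been processed, starting from the all-zero memory. -/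
noncomputable def finalMemory (A : LocalMemoryAlgorithm.{u} r) {k n m : ℕ} (Φ : Formula k n m)
    (ω : A.Seed k n m) : FVertex n m → ℕ :=
  (processingOrder ω.2).foldl (fun μ v => A.f₁ ⟨⟨factorGraph Φ, v, ω.1⟩, μ⟩) fun _ => 0

/-- The output. -/
noncomputable def run (A : LocalMemoryAlgorithm.{u} r) {k n m : ℕ} (Φ : Formula k n m)
    (ω : A.Seed k n m) : Fin n → Bool :=
  fun i => A.f₂ (A.finalMemory Φ ω (Sum.inl i))

end LocalMemoryAlgorithm

/-- The normalized Hamming distance. -/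
noncomputable def normalizedHamming {n : ℕ} (x y : Fin n → Bool) : ℝ := (hammingDist x y : ℝ) / n

/-- `γ` is a coupling of `μ` and `ν`: a joint law with these marginals. -/
def IsCoupling {X Y : Type*} [MeasurableSpace X] [MeasurableSpace Y] (γ : Measure (X × Y))
    (μ : Measure X) (ν : Measure Y) : Prop :=
  γ.fst = μ ∧ γ.snd = ν

/-!
The local algorithm runs the memory algorithm inside a large ball around each vertex, with the same
decorations `φ` and the same processing times `ψ`, which it stores in its decorations. The final
memory of `v` depends only on the vertices from which information flows to `v`: a vertex `w`
influences `v` through a chain of steps of length at most `2r`, along which the processing times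
decrease. So the two outputs agree at `v` unless such a chain leaves the ball of radius `2rL`
(`memoryRun_nbhd`, `LocalMemoryAlgorithm.run_truncation`).

If it does, a shortest chain of influence has at least `L` steps, and in it vertices which are not
consecutive are more than `2r` apart, for otherwise one could skip a part of the chain. Following it
one obtains a lazy walk of length `(2r + 1)L` which revisits vertices only within boundedly many
steps, and which at regular intervals meets `L` vertices with decreasing processing times
(`exists_isFreshWalk`). In the random factor graph the expected number of such walks from a vertex
is at most `C ^ ((2r + 1)L)`, because each step to a new clause costs a factor `1 / n`
(`pow_mul_sum_card_freshFormulas_le`), and the `L` times are in the required order with probability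
at most `1 / L!` (`factorial_mul_strictAnti_le_one`). Hence for large `L` few vertices are expected
to start such a walk.

For concentration, the walks are restricted to variables of degree at most `D`. Then the number of
their starting points changes by a bounded amount when one clause or one processing time is changed,
and the bounded difference inequality (`integral_exp_pi_le`) gives an exponentially small
probability of a large deviation (`measure_card_chainStarts_ge_le`). The other vertices are within
distance `(2r + 1)L` of a variable of degree more than `D`. If `D` is large, there are few of these
except with exponentially small probability: by a union bound, few literals have variables of high
degree (`exists_card_heavyDegree_le`), and this controls the growth of a small set of vertices under
passing to neighbours (`exists_card_reach_highVertices_le`). The probability of failure so obtained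
is even exponentially small in `n`.
-/

/-! ### Balls and embeddings of signed graphs -/

namespace SignedGraph

theorem mem_ball_symm {G : SignedGraph} {r : ℕ} {u v : G.V} (h : u ∈ G.ball r v) :
    v ∈ G.ball r u := by
  obtain ⟨p, hp⟩ := h
  exact ⟨p.reverse, by simpa using hp⟩

theorem mem_ball_trans {G : SignedGraph} {a b : ℕ} {u v w : G.V} (h : v ∈ G.ball a u)
    (h' : w ∈ G.ball b v) : w ∈ G.ball (a + b) u := by
  obtain ⟨p, hp⟩ := h
  obtain ⟨q, hq⟩ := h'
  exact ⟨p.append q, by rw [SimpleGraph.Walk.length_append]; omega⟩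

theorem ball_mono {G : SignedGraph} {a b : ℕ} (hab : a ≤ b) {u v : G.V} (h : v ∈ G.ball a u) :
    v ∈ G.ball b u := by
  obtain ⟨p, hp⟩ := h
  exact ⟨p, hp.trans hab⟩

theorem skeleton_adj_iff {G : SignedGraph} {x y : G.V} :
    G.skeleton.Adj x y ↔ (∃ e, x = Sum.inl (G.va e) ∧ y = Sum.inr (G.cl e)) ∨
      (∃ e, y = Sum.inl (G.va e) ∧ x = Sum.inr (G.cl e)) := by
  rw [skeleton, SimpleGraph.fromRel_adj]
  constructor
  · exact fun h => h.2
  · intro h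
    refine ⟨?_, h⟩
    rcases h with ⟨e, rfl, rfl⟩ | ⟨e, rfl, rfl⟩ <;> simp

/-- An embedding of signed bipartite multigraphs: injective on each of the three sorts, and
compatible with incidences and polarities. -/
structure Emb (H G : SignedGraph) where
  onVa : H.Va → G.Va
  onCl : H.Cl → G.Cl
  onE : H.E → G.E
  inj_va : Function.Injective onVa
  inj_cl : Function.Injective onCl
  inj_e : Function.Injective onE
  map_va : ∀ e, G.va (onE e) = onVa (H.va e)
  map_cl : ∀ e, G.cl (onE e) = onCl (H.cl e)
  map_ρ : ∀ e, G.ρ (onE e) = H.ρ e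

namespace Emb

variable {H G : SignedGraph} (j : Emb H G)

/-- The action of an embedding on the vertices. -/
def onV : H.V → G.V := Sum.map j.onVa j.onCl

/-- The action of an embedding on the vertices and edges. -/
def onSite : H.Site → G.Site := Sum.map j.onV j.onE

theorem onV_injective : Function.Injective j.onV :=
  Function.Injective.sumMap j.inj_va j.inj_cl

theorem adj {a b : H.V} (h : H.skeleton.Adj a b) : G.skeleton.Adj (j.onV a) (j.onV b) := by
  rw [skeleton_adj_iff] at h ⊢
  rcases h with ⟨e, rfl, rfl⟩ | ⟨e, rfl, rfl⟩
  · exact Or.inl ⟨j.onE e, by simp [onV, j.map_va], by simp [onV, j.map_cl]⟩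
  · exact Or.inr ⟨j.onE e, by simp [onV, j.map_va], by simp [onV, j.map_cl]⟩

theorem mem_ball {r : ℕ} {u w : H.V} (h : u ∈ H.ball r w) : j.onV u ∈ G.ball r (j.onV w) := by
  obtain ⟨p, hp⟩ := h
  let g : H.skeleton →g G.skeleton := ⟨j.onV, fun {a b} h => j.adj h⟩
  exact ⟨p.map g, by rw [SimpleGraph.Walk.length_map]; exact hp⟩

/-- The embedding `j` is onto near `w`: it hits all vertices and edges of the `r`-neighbourhood of
the image of `w`. -/
structure FullAt (r : ℕ) (w : H.V) : Prop where
  vertex : ∀ u ∈ G.ball r (j.onV w), ∃ u' ∈ H.ball r w, j.onV u' = u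
  edge : ∀ e, Sum.inl (G.va e) ∈ G.ball r (j.onV w) → Sum.inr (G.cl e) ∈ G.ball r (j.onV w) →
    ∃ e', j.onE e' = e

variable {j}

theorem FullAt.mem_ball_iff {r : ℕ} {w : H.V} (hj : j.FullAt r w) {u : H.V} :
    j.onV u ∈ G.ball r (j.onV w) ↔ u ∈ H.ball r w := by
  constructor
  · intro h
    obtain ⟨u', hu', e⟩ := hj.vertex _ h
    rwa [← j.onV_injective e]
  · exact j.mem_ball

/-- An embedding which is onto near `w` induces an isomorphism of neighbourhoods. -/
noncomputable def FullAt.nbhdIso {r : ℕ} {w : H.V} (hj : j.FullAt r w) :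
    Iso (H.nbhd r w) (G.nbhd r (j.onV w)) where
  onVa := Equiv.ofBijective
    (fun a => ⟨j.onVa a.1, hj.mem_ball_iff (u := Sum.inl a.1) |>.2 a.2⟩) (by
      constructor
      · intro a b h
        exact Subtype.ext (j.inj_va (congrArg Subtype.val h))
      · rintro ⟨a, ha⟩
        obtain ⟨u, hu, e⟩ := hj.vertex _ ha
        rcases u with u | u
        · exact ⟨⟨u, hu⟩, Subtype.ext (Sum.inl_injective e)⟩
        · simp [onV] at e)
  onCl := Equiv.ofBijective
    (fun a => ⟨j.onCl a.1, hj.mem_ball_iff (u := Sum.inr a.1) |>.2 a.2⟩) (by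
      constructor
      · intro a b h
        exact Subtype.ext (j.inj_cl (congrArg Subtype.val h))
      · rintro ⟨a, ha⟩
        obtain ⟨u, hu, e⟩ := hj.vertex _ ha
        rcases u with u | u
        · simp [onV] at e
        · exact ⟨⟨u, hu⟩, Subtype.ext (Sum.inr_injective e)⟩)
  onE := Equiv.ofBijective
    (fun e => ⟨j.onE e.1, by
      rw [j.map_va]; exact hj.mem_ball_iff (u := Sum.inl (H.va e.1)) |>.2 e.2.1, by
      rw [j.map_cl]; exact hj.mem_ball_iff (u := Sum.inr (H.cl e.1)) |>.2 e.2.2⟩) (by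
      constructor
      · intro a b h
        exact Subtype.ext (j.inj_e (congrArg Subtype.val h))
      · rintro ⟨e, h1, h2⟩
        obtain ⟨e', rfl⟩ := hj.edge e h1 h2
        rw [j.map_va] at h1
        rw [j.map_cl] at h2
        exact ⟨⟨e', hj.mem_ball_iff (u := Sum.inl _) |>.1 h1,
          hj.mem_ball_iff (u := Sum.inr _) |>.1 h2⟩, rfl⟩)
  map_va := fun e => Subtype.ext (j.map_va e.1)
  map_cl := fun e => Subtype.ext (j.map_cl e.1)
  map_ρ := fun e => j.map_ρ e.1

theorem FullAt.nbhdV_nbhdIso {r : ℕ} {w : H.V} (hj : j.FullAt r w) (u : (H.nbhd r w).V) :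
    G.nbhdV r (j.onV w) (hj.nbhdIso.onV u) = j.onV (H.nbhdV r w u) := by
  rcases u with u | u <;> rfl

end Emb

theorem nbhdV_injective (G : SignedGraph) (r : ℕ) (v : G.V) :
    Function.Injective (G.nbhdV r v) :=
  Function.Injective.sumMap Subtype.val_injective Subtype.val_injective

theorem exists_nbhdV_eq {G : SignedGraph} {r : ℕ} {v u : G.V} (h : u ∈ G.ball r v) :
    ∃ u', G.nbhdV r v u' = u := by
  rcases u with u | u
  · exact ⟨Sum.inl ⟨u, h⟩, rfl⟩
  · exact ⟨Sum.inr ⟨u, h⟩, rfl⟩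

theorem nbhdV_mem_ball (G : SignedGraph) (r : ℕ) (v : G.V) (u : (G.nbhd r v).V) :
    G.nbhdV r v u ∈ G.ball r v := by
  rcases u with u | u <;> exact u.2

theorem nbhdV_nbhdRoot (G : SignedGraph) (r : ℕ) (v : G.V) :
    G.nbhdV r v (G.nbhdRoot r v) = v := by
  rcases v with v | v <;> rfl

/-- The inclusion of a neighbourhood. -/
def nbhdEmb (G : SignedGraph) (r : ℕ) (v : G.V) : Emb (G.nbhd r v) G where
  onVa := Subtype.val
  onCl := Subtype.val
  onE := Subtype.val
  inj_va := Subtype.val_injective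
  inj_cl := Subtype.val_injective
  inj_e := Subtype.val_injective
  map_va _ := rfl
  map_cl _ := rfl
  map_ρ _ := rfl

theorem nbhd_adj {G : SignedGraph} {r : ℕ} {v : G.V} {a b : (G.nbhd r v).V}
    (h : G.skeleton.Adj (G.nbhdV r v a) (G.nbhdV r v b)) : (G.nbhd r v).skeleton.Adj a b := by
  rw [skeleton_adj_iff] at h ⊢
  rcases h with ⟨e, h1, h2⟩ | ⟨e, h1, h2⟩
  · refine Or.inl ⟨⟨e, ?_, ?_⟩, ?_, ?_⟩
    · rw [← h1]; exact G.nbhdV_mem_ball r v a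
    · rw [← h2]; exact G.nbhdV_mem_ball r v b
    · exact G.nbhdV_injective r v (h1.trans rfl)
    · exact G.nbhdV_injective r v (h2.trans rfl)
  · refine Or.inr ⟨⟨e, ?_, ?_⟩, ?_, ?_⟩
    · rw [← h1]; exact G.nbhdV_mem_ball r v b
    · rw [← h2]; exact G.nbhdV_mem_ball r v a
    · exact G.nbhdV_injective r v (h1.trans rfl)
    · exact G.nbhdV_injective r v (h2.trans rfl)

theorem exists_nbhd_walk {G : SignedGraph} {R : ℕ} {v : G.V} {a b : G.V}
    (p : G.skeleton.Walk a b) (hp : ∀ x ∈ p.support, x ∈ G.ball R v) :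
    ∀ a' : (G.nbhd R v).V, G.nbhdV R v a' = a →
      ∃ (b' : (G.nbhd R v).V) (q : (G.nbhd R v).skeleton.Walk a' b'),
        G.nbhdV R v b' = b ∧ q.length = p.length := by
  induction p with
  | nil => intro a' ha'; exact ⟨a', SimpleGraph.Walk.nil, ha', rfl⟩
  | @cons a c b h p ih =>
    intro a' ha'
    obtain ⟨c', hc'⟩ := exists_nbhdV_eq (hp c (by simp))
    obtain ⟨b', q, hb', hq⟩ := ih (fun x hx => hp x (by simp [hx])) c' hc'
    refine ⟨b', SimpleGraph.Walk.cons (nbhd_adj (by rw [ha', hc']; exact h)) q, hb', ?_⟩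
    simp [hq]

theorem nbhdEmb_fullAt {G : SignedGraph} {R r : ℕ} {v : G.V} {w : (G.nbhd R v).V}
    (h : G.ball r (G.nbhdV R v w) ⊆ G.ball R v) : (G.nbhdEmb R v).FullAt r w where
  vertex := by
    classical
    rintro u ⟨p, hp⟩
    obtain ⟨u', q, hu', hq⟩ := exists_nbhd_walk (v := v) (R := R) p
      (fun x hx => h ⟨p.takeUntil x hx, (p.length_takeUntil_le_length hx).trans hp⟩) w rfl
    exact ⟨u', ⟨q, by omega⟩, hu'⟩
  edge := fun e h1 h2 => ⟨⟨e, h h1, h h2⟩, rfl⟩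

/-- An isomorphism, as an embedding. -/
def Iso.toEmb {H G : SignedGraph} (i : Iso H G) : Emb H G where
  onVa := i.onVa
  onCl := i.onCl
  onE := i.onE
  inj_va := i.onVa.injective
  inj_cl := i.onCl.injective
  inj_e := i.onE.injective
  map_va := i.map_va
  map_cl := i.map_cl
  map_ρ := i.map_ρ

/-- The inverse of an isomorphism. -/
def Iso.symm {H G : SignedGraph} (i : Iso H G) : Iso G H where
  onVa := i.onVa.symm
  onCl := i.onCl.symm
  onE := i.onE.symm
  map_va e := by
    obtain ⟨e, rfl⟩ := i.onE.surjective e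
    simp [i.map_va]
  map_cl e := by
    obtain ⟨e, rfl⟩ := i.onE.surjective e
    simp [i.map_cl]
  map_ρ e := by
    obtain ⟨e, rfl⟩ := i.onE.surjective e
    simp [i.map_ρ]

theorem Iso.onV_symm_onV {H G : SignedGraph} (i : Iso H G) (u : G.V) :
    i.onV (i.symm.onV u) = u := by
  rcases u with u | u <;> simp [Iso.onV, Iso.symm]

theorem Iso.symm_onV_onV {H G : SignedGraph} (i : Iso H G) (u : H.V) :
    i.symm.onV (i.onV u) = u := by
  rcases u with u | u <;> simp [Iso.onV, Iso.symm]

theorem Iso.toEmb_onV {H G : SignedGraph} (i : Iso H G) (u : H.V) : i.toEmb.onV u = i.onV u := by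
  rcases u with u | u <;> rfl

theorem Iso.toEmb_fullAt {H G : SignedGraph} (i : Iso H G) (r : ℕ) (w : H.V) :
    i.toEmb.FullAt r w where
  vertex := by
    intro u hu
    refine ⟨i.symm.onV u, ?_, ?_⟩
    · have := i.symm.toEmb.mem_ball hu
      rwa [Iso.toEmb_onV, Iso.toEmb_onV, Iso.toEmb_onV, Iso.symm_onV_onV] at this
    · rw [Iso.toEmb_onV, Iso.onV_symm_onV]
  edge := fun e _ _ => ⟨i.onE.symm e, i.onE.apply_symm_apply e⟩

/-- The identity embedding. -/
def Emb.refl (G : SignedGraph) : Emb G G where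
  onVa := id
  onCl := id
  onE := id
  inj_va := Function.injective_id
  inj_cl := Function.injective_id
  inj_e := Function.injective_id
  map_va _ := rfl
  map_cl _ := rfl
  map_ρ _ := rfl

theorem Emb.refl_onV (G : SignedGraph) (u : G.V) : (Emb.refl G).onV u = u := by
  rcases u with u | u <;> rfl

theorem Emb.refl_fullAt (G : SignedGraph) (r : ℕ) (w : G.V) : (Emb.refl G).FullAt r w where
  vertex := fun u hu => ⟨u, by rwa [Emb.refl_onV] at hu, Emb.refl_onV G u⟩
  edge := fun e _ _ => ⟨e, rfl⟩

end SignedGraph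

open SignedGraph

/-- A local subroutine commutes with an embedding which is onto near the root. -/
theorem IsLocalSubroutine.map_emb {Ω : Type u} {r : ℕ} {f : (x : MemoryGraph Ω) → (x.G.V → ℕ)}
    (hf : IsLocalSubroutine r f) {H G : SignedGraph} (j : Emb H G) {w : H.V} (hj : j.FullAt r w)
    (φ : H.Site → Ω) (φ' : G.Site → Ω) (hφ : ∀ s, φ' (j.onSite s) = φ s)
    (μ : H.V → ℕ) (μ' : G.V → ℕ) (hμ : ∀ u ∈ H.ball r w, μ' (j.onV u) = μ u)
    {u : H.V} (hu : u ∈ H.ball r w) :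
    f ⟨⟨G, j.onV w, φ'⟩, μ'⟩ (j.onV u) = f ⟨⟨H, w, φ⟩, μ⟩ u := by
  let i : MemoryGraph.Iso (MemoryGraph.nbhd ⟨⟨H, w, φ⟩, μ⟩ r)
      (MemoryGraph.nbhd ⟨⟨G, j.onV w, φ'⟩, μ'⟩ r) :=
    { toGraphIso := hj.nbhdIso
      map_root := by
        apply G.nbhdV_injective r (j.onV w)
        erw [hj.nbhdV_nbhdIso]
        simp [nbhdV_nbhdRoot]
      map_φ := by
        rintro ((s | s) | s)
        · exact hφ (Sum.inl (Sum.inl s.1))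
        · exact hφ (Sum.inl (Sum.inr s.1))
        · exact hφ (Sum.inr s.1)
      map_μ := by
        intro u
        have := hμ _ (H.nbhdV_mem_ball r w u)
        rw [← hj.nbhdV_nbhdIso] at this
        exact this }
  obtain ⟨u', rfl⟩ := exists_nbhdV_eq hu
  have := hf.equivariant _ _ i u'
  rw [← this]
  congr 1
  exact (hj.nbhdV_nbhdIso u').symm

/-! ### Sequential runs of a local subroutine -/

/-- The memory after applying the subroutine `f` at the vertices of the list `l`, in this order,
starting from the memory `μ`. -/
def memoryRun {Ω : Type u} (f : (x : MemoryGraph Ω) → (x.G.V → ℕ)) (G : SignedGraph)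
    (φ : G.Site → Ω) (l : List G.V) (μ : G.V → ℕ) : G.V → ℕ :=
  l.foldl (fun μ v => f ⟨⟨G, v, φ⟩, μ⟩) μ

section Runs

variable {Ω : Type u} {r : ℕ} {f : (x : MemoryGraph Ω) → (x.G.V → ℕ)}

/-- Skipping the vertices outside `F` does not affect the final memory of `v`, provided that a
vertex outside `F` never touches `v` and never touches what a later vertex of `F` reads. -/
theorem memoryRun_filter (hf : IsLocalSubroutine r f) (G : SignedGraph) (φ : G.Site → Ω)
    (F : G.V → Prop) [DecidablePred F] (v : G.V) (l : List G.V)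
    (hl : l.Pairwise fun x w => F w → ¬ F x → ∀ u ∈ G.ball r x, u ∉ G.ball r w)
    (hv : ∀ x ∈ l, ¬ F x → v ∉ G.ball r x) (μ μ' : G.V → ℕ)
    (hμ : ∀ u, (u = v ∨ ∃ w ∈ l, F w ∧ u ∈ G.ball r w) → μ u = μ' u) :
    memoryRun f G φ l μ v = memoryRun f G φ (l.filter F) μ' v := by
  induction l generalizing μ μ' with
  | nil => exact hμ v (Or.inl rfl)
  | cons x l ih =>
    rw [List.pairwise_cons] at hl
    have hv' : ∀ y ∈ l, ¬ F y → v ∉ G.ball r y := fun y hy => hv y (List.mem_cons_of_mem _ hy)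
    by_cases hx : F x
    · rw [List.filter_cons_of_pos (by simpa using hx)]
      refine ih hl.2 hv' _ _ ?_
      intro u hu
      have hu' : μ u = μ' u := by
        refine hμ u (hu.imp_right ?_)
        rintro ⟨w, hw, hw'⟩
        exact ⟨w, List.mem_cons_of_mem _ hw, hw'⟩
      by_cases hux : u ∈ G.ball r x
      · have := hf.map_emb (Emb.refl G) (Emb.refl_fullAt G r x) φ φ
          (by rintro ((s | s) | s) <;> rfl)
          μ' μ (fun y hy => by
            rw [Emb.refl_onV]
            exact hμ y (Or.inr ⟨x, List.mem_cons_self, hx, hy⟩)) hux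
        rw [Emb.refl_onV, Emb.refl_onV] at this
        exact this
      · exact (hf.eq_outside ⟨⟨G, x, φ⟩, μ⟩ u hux).trans
          (hu'.trans (hf.eq_outside ⟨⟨G, x, φ⟩, μ'⟩ u hux).symm)
    · rw [List.filter_cons_of_neg (by simpa using hx)]
      refine ih hl.2 hv' _ _ ?_
      intro u hu
      have hu' : μ u = μ' u := by
        refine hμ u (hu.imp_right ?_)
        rintro ⟨w, hw, hw'⟩
        exact ⟨w, List.mem_cons_of_mem _ hw, hw'⟩
      refine (hf.eq_outside ⟨⟨G, x, φ⟩, μ⟩ u ?_).trans hu'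
      rcases hu with rfl | ⟨w, hw, hFw, huw⟩
      · exact hv x List.mem_cons_self hx
      · exact fun h => hl.1 w hw hFw hx u h huw

/-- Runs commute with an embedding which is onto near all processed vertices. -/
theorem memoryRun_map (hf : IsLocalSubroutine r f) {H G : SignedGraph} (j : Emb H G)
    (φ : H.Site → Ω) (φ' : G.Site → Ω) (hφ : ∀ s, φ' (j.onSite s) = φ s) (l : List H.V)
    (hl : ∀ w ∈ l, j.FullAt r w) (μ : H.V → ℕ) (μ' : G.V → ℕ)
    (hμ : ∀ u, μ' (j.onV u) = μ u) (u : H.V) :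
    memoryRun f G φ' (l.map j.onV) μ' (j.onV u) = memoryRun f H φ l μ u := by
  induction l generalizing μ μ' with
  | nil => exact hμ u
  | cons x l ih =>
    refine ih (fun w hw => hl w (List.mem_cons_of_mem _ hw)) _ _ ?_
    intro y
    have hx := hl x List.mem_cons_self
    by_cases hy : y ∈ H.ball r x
    · exact hf.map_emb j hx φ φ' hφ μ μ' (fun z _ => hμ z) hy
    · exact (hf.eq_outside ⟨⟨G, j.onV x, φ'⟩, μ'⟩ _ (mt hx.mem_ball_iff.1 hy)).trans
        ((hμ y).trans (hf.eq_outside ⟨⟨H, x, φ⟩, μ⟩ y hy).symm)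

end Runs

/-- A list enumerates all elements in strictly increasing order of `ψ`. -/
def IsIncreasingEnum {V : Type*} {X : Type*} [LT X] (ψ : V → X) (l : List V) : Prop :=
  (∀ u, u ∈ l) ∧ l.Pairwise fun x y => ψ x < ψ y

/-- The vertices from which information can flow to `v` when the vertices are processed in
increasing order of `ψ`: those joined to `v` by a chain of steps of length at most `2r` along which
`ψ` decreases, after a first step on which there is no condition on `ψ`. -/
def InfluenceSet {X : Type*} [LT X] (G : SignedGraph) (r : ℕ) (ψ : G.V → X) (v : G.V) :
    Set G.V :=
  {w | ∃ w₁ ∈ G.ball (2 * r) v,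
    Relation.ReflTransGen (fun a b => b ∈ G.ball (2 * r) a ∧ ψ b < ψ a) w₁ w}

section Simulation

variable {Ω : Type u} {r : ℕ} {f : (x : MemoryGraph Ω) → (x.G.V → ℕ)} {X : Type*} [LinearOrder X]

theorem memoryRun_eq_filter_influenceSet (hf : IsLocalSubroutine r f) (G : SignedGraph)
    (φ : G.Site → Ω) (ψ : G.V → X) (v : G.V) (F : G.V → Prop) [DecidablePred F]
    (hF1 : ∀ u ∈ G.ball r v, F u)
    (hF2 : ∀ a b, F a → b ∈ G.ball (2 * r) a → ψ b < ψ a → F b) {l : List G.V}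
    (hl : l.Pairwise fun x y => ψ x < ψ y) :
    memoryRun f G φ l (fun _ => 0) v = memoryRun f G φ (l.filter F) (fun _ => 0) v := by
  refine memoryRun_filter hf G φ F v l (hl.imp ?_) ?_ _ _ (fun _ _ => rfl)
  · intro x w hxw hw hx u hux huw
    refine hx (hF2 w x hw ?_ hxw)
    rw [two_mul]
    exact mem_ball_trans huw (mem_ball_symm hux)
  · exact fun x _ hx hvx => hx (hF1 x (mem_ball_symm hvx))

/-- If the influence set of `v` stays within distance `d` of `v`, then the run on the
neighbourhood of `v` of radius `d + r` or more computes the final memory of `v`. -/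
theorem memoryRun_nbhd (hf : IsLocalSubroutine r f) (G : SignedGraph) (φ : G.Site → Ω)
    (ψ : G.V → X) (v : G.V) {d R : ℕ} (hR : d + r ≤ R)
    (hd : InfluenceSet G r ψ v ⊆ G.ball d v) {l : List G.V}
    (hl : IsIncreasingEnum ψ l) {l' : List (G.nbhd R v).V}
    (hl' : IsIncreasingEnum (ψ ∘ G.nbhdV R v) l') :
    memoryRun f (G.nbhd R v) (φ ∘ G.nbhdSite R v) l' (fun _ => 0)
      (G.nbhdRoot R v) = memoryRun f G φ l (fun _ => 0) v := by
  classical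
  have hsub : ∀ {t : ℕ} {a b : (G.nbhd R v).V}, b ∈ (G.nbhd R v).ball t a →
      G.nbhdV R v b ∈ G.ball t (G.nbhdV R v a) := fun h => (G.nbhdEmb R v).mem_ball h
  let F : G.V → Prop := fun u => u ∈ InfluenceSet G r ψ v
  have hF1 : ∀ u ∈ G.ball r v, F u := fun u hu =>
    ⟨u, ball_mono (by omega) hu, Relation.ReflTransGen.refl⟩
  have hF2 : ∀ a b, F a → b ∈ G.ball (2 * r) a → ψ b < ψ a → F b := by
    rintro a b ⟨w, hw, h⟩ h1 h2
    exact ⟨w, hw, h.tail ⟨h1, h2⟩⟩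
  rw [memoryRun_eq_filter_influenceSet hf G φ ψ v F hF1 hF2 hl.2,
    memoryRun_eq_filter_influenceSet hf (G.nbhd R v) _ (ψ ∘ G.nbhdV R v) (G.nbhdRoot R v)
      (fun u => F (G.nbhdV R v u)) (fun u hu => hF1 _ (by
        have := hsub hu
        rwa [nbhdV_nbhdRoot] at this))
      (fun a b ha hb hab => hF2 _ _ ha (hsub hb) hab) hl'.2]
  have hlist : (l'.filter fun u => F (G.nbhdV R v u)).map (G.nbhdEmb R v).onV = l.filter F := by
    have hs : ∀ (l : List G.V), l.Pairwise (fun x y => ψ x < ψ y) → l.Nodup := fun l h =>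
      h.imp (fun {a b} hab => by rintro rfl; exact lt_irrefl _ hab)
    have h1 : ((l'.filter fun u => F (G.nbhdV R v u)).map (G.nbhdEmb R v).onV).Pairwise
        (fun x y => ψ x < ψ y) := by
      rw [List.pairwise_map]
      exact hl'.2.filter _
    have h2 : (l.filter F).Pairwise (fun x y => ψ x < ψ y) := hl.2.filter _
    refine List.Perm.eq_of_pairwise (le := fun x y => ψ x < ψ y) ?_ h1 h2 ?_
    · intro a b _ _ hab hba
      exact absurd hab hba.not_gt
    · rw [List.perm_ext_iff_of_nodup (hs _ h1) (hs _ h2)]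
      intro u
      simp only [List.mem_map, List.mem_filter, decide_eq_true_eq]
      constructor
      · rintro ⟨a, ⟨-, ha⟩, rfl⟩
        exact ⟨hl.1 _, ha⟩
      · rintro ⟨-, hu⟩
        obtain ⟨a, rfl⟩ := exists_nbhdV_eq (ball_mono (by omega : d ≤ R) (hd hu))
        exact ⟨a, ⟨hl'.1 a, hu⟩, rfl⟩
  rw [← hlist]
  have := memoryRun_map hf (G.nbhdEmb R v) (φ ∘ G.nbhdSite R v) φ (fun _ => rfl)
    (l'.filter fun u => F (G.nbhdV R v u)) (fun w hw => nbhdEmb_fullAt (fun u hu => by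
      have hw' : F (G.nbhdV R v w) := by simpa using (List.mem_filter.1 hw).2
      exact ball_mono hR (mem_ball_trans (hd hw') hu))) (fun _ => 0) (fun _ => 0) (fun _ => rfl)
      (G.nbhdRoot R v)
  rw [← this]
  exact congrArg _ (G.nbhdV_nbhdRoot R v)

end Simulation

/-! ### The simulating local algorithm -/

namespace LocalMemoryAlgorithm

variable {r : ℕ} (A : LocalMemoryAlgorithm.{u} r)

/-- The output at the root of a run of `A` on a whole rooted graph, whose decorations carry the
processing times. If two processing times of vertices agree, the output is `F`. -/
def Simulates (x : RootedGraph (A.Ω × unitInterval)) : Prop :=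
  ∃ l : List x.G.V, IsIncreasingEnum (fun u => (x.φ (Sum.inl u)).2) l ∧
    A.f₂ (memoryRun A.f₁ x.G (fun s => (x.φ s).1) l (fun _ => 0) x.root) = true

theorem Simulates.of_iso {x y : RootedGraph (A.Ω × unitInterval)} (i : RootedGraph.Iso x y)
    (h : A.Simulates x) : A.Simulates y := by
  obtain ⟨l, ⟨h1, h2⟩, h3⟩ := h
  have hV : ∀ u, i.toEmb.onV u = i.onV u := i.toEmb_onV
  have hS : ∀ s, i.toEmb.onSite s = i.onSite s := by rintro ((s | s) | s) <;> rfl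
  have hψ : ∀ u, y.φ (Sum.inl (i.toEmb.onV u)) = x.φ (Sum.inl u) := fun u => by
    rw [hV]; exact i.map_φ (Sum.inl u)
  refine ⟨l.map i.toEmb.onV, ⟨fun u => ?_, ?_⟩, ?_⟩
  · refine List.mem_map.2 ⟨i.toGraphIso.symm.onV u, h1 _, ?_⟩
    rw [hV, Iso.onV_symm_onV]
  · rw [List.pairwise_map]
    simpa only [hψ] using h2
  · rw [← h3, ← i.map_root, ← hV, memoryRun_map A.isLocal i.toEmb (fun s => (x.φ s).1) _
      (fun s => by rw [hS, i.map_φ]) l (fun w _ => i.toGraphIso.toEmb_fullAt r w)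
      (fun _ => 0) _ (fun _ => rfl)]

theorem measurable_memoryRun (G : SignedGraph) (l : List G.V)
    (M : (G.Site → A.Ω) → G.V → ℕ) (hM : Measurable M) :
    Measurable fun φ => memoryRun A.f₁ G φ l (M φ) := by
  induction l generalizing M with
  | nil => exact hM
  | cons x l ih =>
    refine ih (fun φ => A.f₁ ⟨⟨G, x, φ⟩, M φ⟩) ?_
    have h : Measurable (β := G.V → ℕ) fun p : (G.Site → A.Ω) × (G.V → ℕ) =>
        A.f₁ ⟨⟨G, x, p.1⟩, p.2⟩ := by
      refine measurable_from_prod_countable_left fun μ => ?_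
      exact measurable_pi_iff.2 fun u => A.measurable_f₁ G x μ u
    exact h.comp (measurable_id.prodMk hM)

theorem measurableSet_isIncreasingEnum {V : Type*} [Finite V] (l : List V) :
    MeasurableSet {ψ : V → unitInterval | IsIncreasingEnum ψ l} := by
  refine MeasurableSet.inter (MeasurableSet.const _) ?_
  change MeasurableSet {ψ : V → unitInterval | l.Pairwise fun x y => ψ x < ψ y}
  induction l with
  | nil => simp
  | cons x l ih =>
    have : {ψ : V → unitInterval | (x :: l).Pairwise fun x y => ψ x < ψ y} =
        (⋂ y ∈ {y | y ∈ l}, {ψ : V → unitInterval | ψ x < ψ y}) ∩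
          {ψ : V → unitInterval | l.Pairwise fun x y => ψ x < ψ y} := by
      ext ψ
      simp
    rw [this]
    refine MeasurableSet.inter ?_ ih
    refine MeasurableSet.biInter (Set.to_countable _) fun y _ => ?_
    exact measurableSet_lt (measurable_pi_apply x) (measurable_pi_apply y)

open Classical in
/-- The local algorithm which runs `A` inside the neighbourhood of radius `R` of each vertex. Its
decorations carry those of `A` together with the processing times of the vertices. -/
noncomputable def truncation (R : ℕ) : LocalAlgorithm.{u} R where
  Ω := A.Ω × unitInterval
  P := A.P.prod volume
  f := fun x => decide (A.Simulates (x.nbhd R))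
  isLocal := by
    rintro x y ⟨i⟩
    have i' : RootedGraph.Iso (y.nbhd R) (x.nbhd R) :=
      { toGraphIso := i.toGraphIso.symm
        map_root := by rw [← i.map_root, Iso.symm_onV_onV]
        map_φ := by
          intro s
          rw [← i.map_φ]
          congr 1
          rcases s with (s | s) | s <;>
            simp [Iso.onSite, Iso.onV, Iso.symm] }
    exact decide_eq_decide.2 ⟨Simulates.of_iso A i, Simulates.of_iso A i'⟩
  measurable_f := by
    intro G v
    refine measurable_to_bool ?_
    have : (fun φ : G.Site → A.Ω × unitInterval =>
        decide (A.Simulates (RootedGraph.nbhd ⟨G, v, φ⟩ R))) ⁻¹' {true} =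
        ⋃ l : List (G.nbhd R v).V,
          (fun φ u => (φ (G.nbhdSite R v (Sum.inl u))).2) ⁻¹' {ψ | IsIncreasingEnum ψ l} ∩
          (fun φ => A.f₂ (memoryRun A.f₁ (G.nbhd R v) (fun s => (φ (G.nbhdSite R v s)).1) l
            (fun _ => 0) (G.nbhdRoot R v))) ⁻¹' {true} := by
      ext φ
      simp only [Set.mem_preimage, Set.mem_singleton_iff, decide_eq_true_eq, Set.mem_iUnion,
        Set.mem_inter_iff, Set.mem_ofPred_eq]
      rfl
    rw [this]
    refine MeasurableSet.iUnion fun l => MeasurableSet.inter ?_ ?_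
    · refine measurableSet_preimage ?_ (measurableSet_isIncreasingEnum l)
      exact measurable_pi_iff.2 fun u => measurable_snd.comp (measurable_pi_apply _)
    · refine measurableSet_preimage ?_ (MeasurableSet.singleton _)
      refine (measurable_of_countable A.f₂).comp ((measurable_pi_apply _).comp ?_)
      refine (A.measurable_memoryRun (G.nbhd R v) l (fun _ _ => 0) measurable_const).comp ?_
      exact measurable_pi_iff.2 fun s => measurable_fst.comp (measurable_pi_apply _)

end LocalMemoryAlgorithm

theorem isIncreasingEnum_insertionSort {V X : Type*} [LinearOrder X] {ψ : V → X}
    (hψ : Function.Injective ψ) {l : List V} (hl : l.Nodup) (hl' : ∀ u, u ∈ l) :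
    IsIncreasingEnum ψ (l.insertionSort fun x y => ψ x ≤ ψ y) := by
  have : Std.Total (fun x y : V => ψ x ≤ ψ y) := ⟨fun x y => le_total _ _⟩
  have : IsTrans V (fun x y : V => ψ x ≤ ψ y) := ⟨fun x y z h h' => h.trans h'⟩
  refine ⟨fun u => (List.mem_insertionSort _).2 (hl' u), ?_⟩
  have h1 := List.pairwise_insertionSort (fun x y : V => ψ x ≤ ψ y) l
  have h2 : (l.insertionSort fun x y => ψ x ≤ ψ y).Pairwise (· ≠ ·) :=
    (List.perm_insertionSort (fun x y : V => ψ x ≤ ψ y) l).nodup_iff.2 hl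
  exact (h1.and h2).imp fun {a b} h => h.1.lt_of_ne fun e => h.2 (hψ e)

theorem exists_isIncreasingEnum {V X : Type*} [Finite V] [LinearOrder X] {ψ : V → X}
    (hψ : Function.Injective ψ) : ∃ l : List V, IsIncreasingEnum ψ l := by
  have := Fintype.ofFinite V
  exact ⟨_, isIncreasingEnum_insertionSort hψ Finset.univ.nodup_toList fun u => by simp⟩

theorem isIncreasingEnum_processingOrder {n m : ℕ} {ψ : FVertex n m → unitInterval}
    (hψ : Function.Injective ψ) : IsIncreasingEnum ψ (processingOrder ψ) := by
  refine isIncreasingEnum_insertionSort hψ ?_ ?_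
  · refine List.Nodup.append ((List.nodup_finRange n).map Sum.inl_injective)
      ((List.nodup_finRange m).map Sum.inr_injective) ?_
    intro x hx hy
    simp only [List.mem_map] at hx hy
    obtain ⟨a, -, rfl⟩ := hx
    obtain ⟨b, -, h⟩ := hy
    exact absurd h (by simp)
  · rintro (u | u) <;> simp

namespace LocalMemoryAlgorithm

variable {r : ℕ} (A : LocalMemoryAlgorithm.{u} r) {k n m : ℕ}

/-- The seed of `A` contained in a seed of its truncation. -/
def seedOfTruncation {R : ℕ} (φ' : (A.truncation R).Seed k n m) : A.Seed k n m :=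
  (fun s => (φ' s).1, fun v => (φ' (Sum.inl v)).2)

/-- Where the influence set is small and there are no ties, the truncation agrees with `A`. -/
theorem run_truncation {d R : ℕ} (hR : d + r ≤ R) (Φ : Formula k n m)
    (φ' : (A.truncation R).Seed k n m)
    (hψ : Function.Injective (A.seedOfTruncation φ').2) (i : Fin n)
    (hd : InfluenceSet (factorGraph Φ) r (A.seedOfTruncation φ').2 (Sum.inl i) ⊆
      (factorGraph Φ).ball d (Sum.inl i)) :
    A.run Φ (A.seedOfTruncation φ') i = (A.truncation R).run Φ φ' i := by
  have key : ∀ l' : List ((factorGraph Φ).nbhd R (Sum.inl i)).V,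
      IsIncreasingEnum ((A.seedOfTruncation φ').2 ∘ (factorGraph Φ).nbhdV R (Sum.inl i)) l' →
      memoryRun A.f₁ ((factorGraph Φ).nbhd R (Sum.inl i))
        ((A.seedOfTruncation φ').1 ∘ (factorGraph Φ).nbhdSite R (Sum.inl i)) l' (fun _ => 0)
        ((factorGraph Φ).nbhdRoot R (Sum.inl i)) =
      A.finalMemory Φ (A.seedOfTruncation φ') (Sum.inl i) := fun l' hl' =>
    memoryRun_nbhd A.isLocal (factorGraph Φ) _ (A.seedOfTruncation φ').2 (Sum.inl i) hR hd
      (isIncreasingEnum_processingOrder hψ) hl'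
  obtain ⟨l, hl⟩ := exists_isIncreasingEnum
    (hψ.comp ((factorGraph Φ).nbhdV_injective R (Sum.inl i)))
  have hsim : A.Simulates (RootedGraph.nbhd ⟨factorGraph Φ, Sum.inl i, φ'⟩ R) ↔
      A.f₂ (A.finalMemory Φ (A.seedOfTruncation φ') (Sum.inl i)) = true := by
    constructor
    · rintro ⟨l', h1, h2⟩
      rw [← key l' h1]
      exact h2
    · intro h
      refine ⟨l, hl, ?_⟩
      rw [← key l hl] at h
      exact h
  rw [Bool.eq_iff_iff]
  exact hsim.symm.trans (@decide_eq_true_iff _ (Classical.propDecidable _)).symm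

theorem measurable_run (Φ : Formula k n m) :
    Measurable (A.run Φ : A.Seed k n m → Fin n → Bool) := by
  let _ : MeasurableSpace (List (FVertex n m)) := ⊤
  have hcount : Countable (List (FVertex n m)) := inferInstance
  have h1 : Measurable (processingOrder : (FVertex n m → unitInterval) → List (FVertex n m)) := by
    classical
    let g : (FVertex n m → FVertex n m → Bool) → List (FVertex n m) := fun b =>
      ((List.finRange n).map Sum.inl ++ (List.finRange m).map Sum.inr).insertionSort
        fun x y => b x y = true
    have hg : (processingOrder : (FVertex n m → unitInterval) → List (FVertex n m)) =
        g ∘ fun ψ x y => decide (ψ x ≤ ψ y) := by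
      funext ψ
      simp only [processingOrder, g, Function.comp, decide_eq_true_eq]
    rw [hg]
    refine (measurable_of_countable g).comp ?_
    refine measurable_pi_iff.2 fun x => measurable_pi_iff.2 fun y => measurable_to_bool ?_
    have : (fun ψ : FVertex n m → unitInterval => decide (ψ x ≤ ψ y)) ⁻¹' {true} =
        {ψ | ψ x ≤ ψ y} := by
      ext ψ
      simp
    rw [this]
    exact measurableSet_le (measurable_pi_apply x) (measurable_pi_apply y)
  have h2 : Measurable fun p : (FSite k n m → A.Ω) × List (FVertex n m) =>
      memoryRun A.f₁ (factorGraph Φ) p.1 p.2 (fun _ => 0) := by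
    refine measurable_from_prod_countable_left fun l => ?_
    exact A.measurable_memoryRun (factorGraph Φ) l (fun _ _ => 0) measurable_const
  have h3 : Measurable fun ω : A.Seed k n m => A.finalMemory Φ ω :=
    h2.comp (measurable_fst.prodMk (h1.comp measurable_snd))
  refine measurable_pi_iff.2 fun i => ?_
  exact (measurable_of_countable A.f₂).comp ((measurable_pi_apply (Sum.inl i)).comp h3)

end LocalMemoryAlgorithm

theorem LocalAlgorithm.measurable_run {R : ℕ} (A : LocalAlgorithm.{u} R) {k n m : ℕ}
    (Φ : Formula k n m) : Measurable (A.run Φ : A.Seed k n m → Fin n → Bool) :=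
  measurable_pi_iff.2 fun i => A.measurable_f (factorGraph Φ) (Sum.inl i)

namespace LocalMemoryAlgorithm

variable {r : ℕ} (A : LocalMemoryAlgorithm.{u} r) {k n m : ℕ}

theorem measurePreserving_seedOfTruncation (R : ℕ) :
    MeasurePreserving (A.seedOfTruncation : (A.truncation R).Seed k n m → A.Seed k n m)
      ((A.truncation R).seedLaw k n m) (A.seedLaw k n m) := by
  have h1 := measurePreserving_arrowProdEquivProdArrow A.Ω unitInterval (FSite k n m)
    (fun _ => A.P) (fun _ => volume)
  have h2 := (measurePreserving_fst (μ := Measure.pi fun _ : FVertex n m => volume)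
    (ν := Measure.pi fun _ : Fin m × Fin k => (volume : Measure unitInterval))).comp
    (measurePreserving_sumPiEquivProdPi
      (X := fun _ : FVertex n m ⊕ (Fin m × Fin k) => unitInterval) fun _ => volume)
  exact ((MeasurePreserving.id (Measure.pi fun _ : FSite k n m => A.P)).prod h2).comp h1

/-- The coupling of the seeds of `A` and of its truncation which uses the same decorations and the
same processing times. -/
noncomputable def seedCoupling (R k n m : ℕ) :
    Measure (A.Seed k n m × (A.truncation R).Seed k n m) :=
  ((A.truncation R).seedLaw k n m).map fun φ' => (A.seedOfTruncation φ', φ')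

theorem isCoupling_seedCoupling (R : ℕ) :
    IsCoupling (A.seedCoupling R k n m) (A.seedLaw k n m) ((A.truncation R).seedLaw k n m) := by
  have h := A.measurePreserving_seedOfTruncation (k := k) (n := n) (m := m) R
  constructor
  · rw [seedCoupling, Measure.fst, Measure.map_map measurable_fst
      (h.measurable.prodMk measurable_id')]
    exact h.map_eq
  · rw [seedCoupling, Measure.snd, Measure.map_map measurable_snd
      (h.measurable.prodMk measurable_id')]
    exact Measure.map_id

instance (R k n m : ℕ) : IsProbabilityMeasure ((A.truncation R).seedLaw k n m) := by
  unfold LocalAlgorithm.seedLaw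
  infer_instance

theorem measurable_normalizedHamming {Z : Type*} [MeasurableSpace Z] {f g : Z → Fin n → Bool}
    (hf : Measurable f) (hg : Measurable g) :
    Measurable fun z => normalizedHamming (f z) (g z) := by
  have h : Measurable (Function.uncurry (normalizedHamming (n := n))) := measurable_of_countable _
  simpa only [Function.comp_def, Function.uncurry] using h.comp (hf.prodMk hg)

/-- A bound on the disagreement probability of `A` and its truncation, from a description of the
seeds and formulas for which they may disagree much in terms of the processing times alone. -/
theorem prod_seedCoupling_le {R : ℕ} {η : ℝ}
    {B : Set (Formula k n m × (FVertex n m → unitInterval))}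
    (hBm : MeasurableSet B)
    (hB : ∀ (Φ : Formula k n m) (φ' : (A.truncation R).Seed k n m),
      η ≤ normalizedHamming (A.run Φ (A.seedOfTruncation φ')) ((A.truncation R).run Φ φ') →
      (Φ, (A.seedOfTruncation φ').2) ∈ B)
    (ν : Measure (Formula k n m)) [IsProbabilityMeasure ν] :
    (ν.prod (A.seedCoupling R k n m))
      {ω | η ≤ normalizedHamming (A.run ω.1 ω.2.1) ((A.truncation R).run ω.1 ω.2.2)} ≤
    (ν.prod (Measure.pi fun _ => volume)) B := by
  have h := A.measurePreserving_seedOfTruncation (k := k) (n := n) (m := m) R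
  have h2 : MeasurePreserving
      (fun φ' : (A.truncation R).Seed k n m => (A.seedOfTruncation φ', φ'))
      ((A.truncation R).seedLaw k n m) (A.seedCoupling R k n m) :=
    ⟨h.measurable.prodMk measurable_id, rfl⟩
  have : IsProbabilityMeasure (A.seedLaw k n m) := by
    unfold seedLaw
    infer_instance
  have : IsProbabilityMeasure (A.seedCoupling R k n m) :=
    Measure.isProbabilityMeasure_map h2.measurable.aemeasurable
  have h3 := (MeasurePreserving.id ν).prod h2
  have h4 := (MeasurePreserving.id ν).prod ((measurePreserving_snd
    (μ := Measure.pi fun _ : FSite k n m => A.P)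
    (ν := Measure.pi fun _ : FVertex n m => (volume : Measure unitInterval))).comp h)
  have hrun : Measurable fun ω : Formula k n m × (A.Seed k n m × (A.truncation R).Seed k n m) =>
      normalizedHamming (A.run ω.1 ω.2.1) ((A.truncation R).run ω.1 ω.2.2) := by
    refine measurable_from_prod_countable_right fun Φ => ?_
    have h6 : Measurable fun q : A.Seed k n m × (A.truncation R).Seed k n m => A.run Φ q.1 :=
      (A.measurable_run Φ).comp measurable_fst
    have h7 : Measurable fun q : A.Seed k n m × (A.truncation R).Seed k n m =>
        (A.truncation R).run Φ q.2 :=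
      ((A.truncation R).measurable_run Φ).comp measurable_snd
    exact measurable_normalizedHamming h6 h7
  have h6 := h3.measure_preimage
    (measurableSet_le (measurable_const (a := η)) hrun).nullMeasurableSet
  have h7 := h4.measure_preimage hBm.nullMeasurableSet
  refine h6.symm.trans_le (le_trans (measure_mono ?_) h7.le)
  exact fun ω hω => hB ω.1 ω.2 hω

end LocalMemoryAlgorithm

/-! ### Long chains of influence produce fresh walks -/

section Chains

variable {X : Type*} [LinearOrder X] {G : SignedGraph} {r : ℕ} {ψ : G.V → X} {v : G.V}

/-- `u` is reached from `v` by a chain of influence of exactly `t` steps. -/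
def ReachedIn (G : SignedGraph) (r : ℕ) (ψ : G.V → X) (v : G.V) : ℕ → G.V → Prop
  | 0, u => u = v
  | t + 1, u => ∃ u', ReachedIn G r ψ v t u' ∧ u ∈ G.ball (2 * r) u' ∧ (t = 0 ∨ ψ u < ψ u')

theorem ReachedIn.mem_ball {t : ℕ} {u : G.V} (h : ReachedIn G r ψ v t u) :
    u ∈ G.ball (2 * r * t) v := by
  induction t generalizing u with
  | zero => rw [show u = v from h]; exact G.mem_ball_self _ v
  | succ t ih =>
    obtain ⟨u', h1, h2, -⟩ := h
    exact mem_ball_trans (ih h1) h2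

theorem exists_reachedIn {u : G.V} (h : u ∈ InfluenceSet G r ψ v) :
    ∃ t, ReachedIn G r ψ v t u := by
  obtain ⟨w, hw, h⟩ := h
  suffices ∃ t, ReachedIn G r ψ v (t + 1) u from ⟨_, this.choose_spec⟩
  induction h with
  | refl => exact ⟨0, v, rfl, hw, Or.inl rfl⟩
  | tail _ hab ih =>
    obtain ⟨t, ht⟩ := ih
    exact ⟨t + 1, _, ht, hab.1, Or.inr hab.2⟩

/-- A shortest chain of influence to `u`. -/
theorem exists_chain_of_isLeast {t : ℕ} {u : G.V} (h : IsLeast {t | ReachedIn G r ψ v t u} t) :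
    ∃ w : ℕ → G.V, w t = u ∧ (∀ i ≤ t, IsLeast {t | ReachedIn G r ψ v t (w i)} i) ∧
      ∀ i < t, w (i + 1) ∈ G.ball (2 * r) (w i) ∧ (1 ≤ i → ψ (w (i + 1)) < ψ (w i)) := by
  induction t generalizing u with
  | zero =>
    refine ⟨fun _ => u, rfl, fun i hi => ?_, fun i hi => by omega⟩
    rwa [Nat.le_zero.1 hi]
  | succ t ih =>
    obtain ⟨u', h1, h2, h3⟩ := h.1
    have hu' : IsLeast {t | ReachedIn G r ψ v t u'} t := by
      refine ⟨h1, fun s hs => ?_⟩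
      by_contra! hst
      have : ReachedIn G r ψ v (s + 1) u := ⟨u', hs, h2, Or.inr (h3.resolve_left (by omega))⟩
      have : t + 1 ≤ s + 1 := h.2 this
      omega
    obtain ⟨w, hw, hw1, hw2⟩ := ih hu'
    refine ⟨fun i => if i ≤ t then w i else u, by simp, fun i hi => ?_, fun i hi => ?_⟩
    · dsimp only
      split_ifs with hit
      · exact hw1 i hit
      · rwa [show i = t + 1 by omega]
    · dsimp only
      rw [if_pos (by omega : i ≤ t)]
      split_ifs with hit
      · exact hw2 i hit
      · obtain rfl : i = t := by omega
        rw [hw]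
        exact ⟨h2, fun hi => h3.resolve_left (by omega)⟩

/-- In a shortest chain, vertices which are not consecutive are far apart: otherwise the part of
the chain between them could be skipped. -/
theorem notMem_ball_of_chain {t : ℕ} {w : ℕ → G.V}
    (h1 : ∀ i ≤ t, IsLeast {t | ReachedIn G r ψ v t (w i)} i)
    (h2 : ∀ i < t, w (i + 1) ∈ G.ball (2 * r) (w i) ∧ (1 ≤ i → ψ (w (i + 1)) < ψ (w i)))
    {i j : ℕ} (hij : i + 2 ≤ j) (hj : j ≤ t) : w j ∉ G.ball (2 * r) (w i) := by
  intro hw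
  have hψ : i = 0 ∨ ψ (w j) < ψ (w i) := by
    rcases Nat.eq_zero_or_pos i with h | h
    · exact Or.inl h
    · right
      have : ∀ d, i + d + 1 ≤ t → ψ (w (i + d + 1)) < ψ (w i) := by
        intro d
        induction d with
        | zero => exact fun hd => (h2 i (by omega)).2 h
        | succ d ih =>
          exact fun hd => ((h2 (i + d + 1) (by omega)).2 (by omega)).trans (ih (by omega))
      have := this (j - i - 1) (by omega)
      rwa [show i + (j - i - 1) + 1 = j by omega] at this
  have : ReachedIn G r ψ v (i + 1) (w j) := ⟨w i, (h1 i (by omega)).1, hw, hψ⟩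
  have : j ≤ i + 1 := (h1 j hj).2 this
  omega

end Chains

/-- A lazy walk of length `ℓ`, which revisits a vertex only within `W` steps. -/
structure IsFreshWalk {V : Type*} (Γ : SimpleGraph V) (W : ℕ) {ℓ : ℕ} (p : Fin (ℓ + 1) → V) :
    Prop where
  step : ∀ i : Fin ℓ, p i.succ = p i.castSucc ∨ Γ.Adj (p i.castSucc) (p i.succ)
  fresh : ∀ a b : Fin (ℓ + 1), p a = p b → (b : ℕ) ≤ a + W

/-- The vertices at times `s, 2s, …, Ls` of a walk of length `sL`. -/
def sampleWalk {V : Type*} {s L : ℕ} (p : Fin (s * L + 1) → V) (i : Fin L) : V :=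
  p ⟨s * (i + 1), Nat.lt_succ_of_le (Nat.mul_le_mul_left s i.2)⟩

open SimpleGraph in
/-- If the influence set of `v` leaves the ball of radius `2rL`, then some fresh walk from `v` of
length `(2r + 1)L` meets `L` vertices with decreasing processing times at regular intervals: the
walk follows a shortest chain of influence. -/
theorem exists_isFreshWalk {X : Type*} [LinearOrder X] {G : SignedGraph} {r L : ℕ}
    {ψ : G.V → X} {v : G.V} (h : ¬ InfluenceSet G r ψ v ⊆ G.ball (2 * r * L) v) :
    ∃ p : Fin ((2 * r + 1) * L + 1) → G.V, p 0 = v ∧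
      IsFreshWalk G.skeleton (3 * (2 * r + 1)) p ∧ StrictAnti (ψ ∘ sampleWalk p) := by
  classical
  obtain ⟨u, hu, huv⟩ := Set.not_subset.1 h
  have hex := exists_reachedIn hu
  set t := Nat.find hex with ht
  have hleast : IsLeast {t | ReachedIn G r ψ v t u} t :=
    ⟨Nat.find_spec hex, fun s hs => Nat.find_min' hex hs⟩
  have hLt : L < t := by
    by_contra! hle
    exact huv (ball_mono (Nat.mul_le_mul_left _ hle) (ReachedIn.mem_ball hleast.1))
  obtain ⟨w, -, hw1, hw2⟩ := exists_chain_of_isLeast hleast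
  choose q hq using fun (i : ℕ) (hi : i < t) => (hw2 i hi).1
  set s := 2 * r + 1 with hs
  -- Each segment of the walk takes `s` steps: it follows `q i`, then waits at its end.
  let p : ℕ → G.V := fun a => if h : a / s < t then (q (a / s) h).getVert (a % s) else v
  have hp : ∀ i d, ∀ h : i < t, d < s → p (s * i + d) = (q i h).getVert d := by
    intro i d h hd
    have h1 : (s * i + d) / s = i := by
      rw [Nat.mul_add_div (by omega), Nat.div_eq_of_lt hd, add_zero]
    have h2 : (s * i + d) % s = d := by
      rw [Nat.mul_add_mod, Nat.mod_eq_of_lt hd]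
    have : ∀ i' d', i' = i → d' = d →
        (if h : i' < t then (q i' h).getVert d' else v) = (q i h).getVert d := by
      rintro _ _ rfl rfl
      exact dif_pos h
    exact this _ _ h1 h2
  have hpw : ∀ i, i < t → p (s * i) = w i := by
    intro i h
    have := hp i 0 h (by omega)
    rwa [add_zero, Walk.getVert_zero] at this
  have hstep : ∀ a, a / s < L → p (a + 1) = p a ∨ G.skeleton.Adj (p a) (p (a + 1)) := by
    intro a ha
    have e := Nat.div_add_mod a s
    have hd := Nat.mod_lt a (by omega : s > 0)
    generalize a / s = i at *
    generalize a % s = d at *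
    subst e
    rw [hp i d (by omega) hd]
    by_cases hd' : d + 1 < s
    · rw [add_assoc, hp i (d + 1) (by omega) hd']
      by_cases hlen : d < (q i (by omega)).length
      · exact Or.inr (Walk.adj_getVert_succ _ hlen)
      · left
        rw [Walk.getVert_of_length_le _ (by omega), Walk.getVert_of_length_le _ (by omega)]
    · left
      rw [show s * i + d + 1 = s * (i + 1) by rw [mul_add]; omega, hpw _ (by omega),
        Walk.getVert_of_length_le _ ((hq i (by omega)).trans (by omega))]
  -- A point on a path of length at most `2r` is within distance `r` of one of its ends.
  have hnear : ∀ a, a / s < t → ∃ i, a / s ≤ i ∧ i ≤ a / s + 1 ∧ p a ∈ G.ball r (w i) := by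
    intro a ha
    have e := Nat.div_add_mod a s
    have hd := Nat.mod_lt a (by omega : s > 0)
    generalize a / s = i at *
    generalize a % s = d at *
    subst e
    rw [hp i d ha hd]
    by_cases hdr : d ≤ r
    · exact ⟨i, le_rfl, by omega, (q i ha).take d, by rw [Walk.take_length]; omega⟩
    · refine ⟨i + 1, by omega, le_rfl, ((q i ha).drop d).reverse, ?_⟩
      rw [Walk.length_reverse, Walk.drop_length]
      have := hq i ha
      omega
  refine ⟨fun a => p a, ?_, ⟨?_, ?_⟩, ?_⟩
  · have := hpw 0 (by omega)
    rw [mul_zero] at this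
    refine this.trans ?_
    exact (hw1 0 (by omega)).1
  · rintro ⟨i, hi⟩
    exact hstep i (Nat.div_lt_of_lt_mul hi)
  · rintro ⟨a, ha⟩ ⟨b, hb⟩ hab
    by_contra! hlt
    dsimp only at hab hlt
    have hbt : b / s < t := by
      have : b / s ≤ L := Nat.div_le_of_le_mul (by omega)
      omega
    have h3 : a / s + 3 ≤ b / s := by
      rw [Nat.le_div_iff_mul_le (by omega), add_mul]
      have := Nat.div_mul_le_self a s
      omega
    obtain ⟨i, hi1, hi2, hi⟩ := hnear a (by omega)
    obtain ⟨j, hj1, hj2, hj⟩ := hnear b hbt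
    rw [hab] at hi
    refine notMem_ball_of_chain hw1 hw2 (i := i) (j := j) (by omega) (by omega) ?_
    rw [two_mul]
    exact mem_ball_trans hi (mem_ball_symm hj)
  · have hmono : ∀ d i, 1 ≤ i → i + d + 1 ≤ L → ψ (w (i + d + 1)) < ψ (w i) := by
      intro d
      induction d with
      | zero => exact fun i hi hd => (hw2 i (by omega)).2 hi
      | succ d ih =>
        exact fun i hi hd => ((hw2 (i + d + 1) (by omega)).2 (by omega)).trans
          (ih i hi (by omega))
    intro i j hij
    simp only [Function.comp, sampleWalk]
    rw [hpw _ (by omega), hpw _ (by omega)]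
    have := hmono (j - i - 1) (i + 1) (by omega) (by omega)
    rwa [show (i : ℕ) + 1 + (j - i - 1) + 1 = j + 1 by omega] at this

/-! ### Counting fresh walks in the random factor graph -/

section Counting

variable {k n m : ℕ}

theorem factorGraph_adj_inl_inr {Φ : Formula k n m} {x : Fin n} {c : Fin m} :
    (factorGraph Φ).skeleton.Adj (Sum.inl x) (Sum.inr c) ↔ ∃ j, (Φ c j).1 = x := by
  rw [skeleton_adj_iff]
  constructor
  · rintro (⟨⟨c', j⟩, h1, h2⟩ | ⟨e, h1, h2⟩)
    · obtain rfl : c = c' := Sum.inr_injective h2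
      exact ⟨j, (Sum.inl_injective h1).symm⟩
    · simp at h1
  · rintro ⟨j, rfl⟩
    exact Or.inl ⟨(c, j), rfl, rfl⟩

theorem factorGraph_not_adj_inl_inl {Φ : Formula k n m} {x y : Fin n} :
    ¬ (factorGraph Φ).skeleton.Adj (Sum.inl x) (Sum.inl y) := by
  rw [skeleton_adj_iff]
  rintro (⟨e, h1, h2⟩ | ⟨e, h1, h2⟩)
  · simp at h2
  · simp at h2

theorem factorGraph_not_adj_inr_inr {Φ : Formula k n m} {c d : Fin m} :
    ¬ (factorGraph Φ).skeleton.Adj (Sum.inr c) (Sum.inr d) := by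
  rw [skeleton_adj_iff]
  rintro (⟨e, h1, h2⟩ | ⟨e, h1, h2⟩)
  · simp at h1
  · simp at h1

/-- Two formulas with the same clause `c` have the same adjacencies at the vertex `c`. -/
theorem factorGraph_adj_congr {Φ Φ' : Formula k n m} {a b : FVertex n m}
    (h : ∀ c, a = Sum.inr c ∨ b = Sum.inr c → Φ c = Φ' c)
    (hab : (factorGraph Φ).skeleton.Adj a b) : (factorGraph Φ').skeleton.Adj a b := by
  rcases a with x | c <;> rcases b with y | d
  · exact absurd hab factorGraph_not_adj_inl_inl
  · rw [factorGraph_adj_inl_inr] at hab ⊢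
    rwa [← h d (Or.inr rfl)]
  · have hab := hab.symm
    refine SimpleGraph.Adj.symm ?_
    rw [factorGraph_adj_inl_inr] at hab ⊢
    rwa [← h c (Or.inl rfl)]
  · exact absurd hab factorGraph_not_adj_inr_inr

/-- In a set of formulas on which clause `c` is unconstrained, a given variable is the variable of a
given literal of `c` for a fraction `1 / n` of the formulas. -/
theorem card_literal_eq (S : Finset (Formula k n m)) (c : Fin m)
    (hS : ∀ Φ ∈ S, ∀ C, Function.update Φ c C ∈ S) (j : Fin k) (x : Fin n) :
    n * (S.filter fun Φ => (Φ c j).1 = x).card = S.card := by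
  classical
  -- Exchanging `x` and `y` in this literal shows that all variables are equally likely.
  let σ : Fin n → Formula k n m → Formula k n m := fun y Φ =>
    Function.update Φ c (Function.update (Φ c) j (Equiv.swap x y (Φ c j).1, (Φ c j).2))
  have hσ : ∀ y Φ, σ y (σ y Φ) = Φ := by
    intro y Φ
    simp [σ]
  have hσv : ∀ y Φ, (σ y Φ c j).1 = Equiv.swap x y (Φ c j).1 := by
    intro y Φ
    simp [σ]
  have h : ∀ y, (S.filter fun Φ => (Φ c j).1 = y).card =
      (S.filter fun Φ => (Φ c j).1 = x).card := by
    intro y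
    refine Finset.card_nbij' (σ y) (σ y) ?_ ?_ (fun Φ _ => hσ y Φ) (fun Φ _ => hσ y Φ)
    · intro Φ hΦ
      simp only [Finset.coe_filter, Set.mem_ofPred_eq] at hΦ ⊢
      exact ⟨hS Φ hΦ.1 _, by rw [hσv, hΦ.2, Equiv.swap_apply_right]⟩
    · intro Φ hΦ
      simp only [Finset.coe_filter, Set.mem_ofPred_eq] at hΦ ⊢
      exact ⟨hS Φ hΦ.1 _, by rw [hσv, hΦ.2, Equiv.swap_apply_left]⟩
  rw [Finset.card_eq_sum_card_fiberwise (s := S) (f := fun Φ : Formula k n m => (Φ c j).1)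
    (t := Finset.univ) (fun _ _ => Finset.mem_coe.2 (Finset.mem_univ _)),
    Finset.sum_congr rfl fun y _ => h y]
  simp

open Classical in
/-- The formulas in whose factor graph `p` is a fresh walk. -/
noncomputable def freshFormulas (k : ℕ) {n m : ℕ} (W : ℕ) {ℓ : ℕ} (p : Fin (ℓ + 1) → FVertex n m) :
    Finset (Formula k n m) :=
  Finset.univ.filter fun Φ => IsFreshWalk (factorGraph Φ).skeleton W p

theorem mem_freshFormulas {W ℓ : ℕ} {p : Fin (ℓ + 1) → FVertex n m} {Φ : Formula k n m} :
    Φ ∈ freshFormulas k W p ↔ IsFreshWalk (factorGraph Φ).skeleton W p := by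
  simp [freshFormulas]

theorem update_mem_freshFormulas {W ℓ : ℕ} {p : Fin (ℓ + 1) → FVertex n m} {Φ : Formula k n m}
    (h : Φ ∈ freshFormulas k W p) {c : Fin m} (hc : ∀ i, p i ≠ Sum.inr c)
    (C : Fin k → Fin n × Bool) : Function.update Φ c C ∈ freshFormulas k W p := by
  rw [mem_freshFormulas] at h ⊢
  refine ⟨fun i => (h.step i).imp_right (factorGraph_adj_congr ?_), h.fresh⟩
  rintro d (hd | hd)
  · rw [Function.update_of_ne]
    rintro rfl
    exact hc _ hd
  · rw [Function.update_of_ne]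
    rintro rfl
    exact hc _ hd

/-- A fresh walk continues either to one of its last `W` vertices, or to a new neighbour. -/
theorem IsFreshWalk.snoc {V : Type*} {Γ : SimpleGraph V} {W : ℕ} {ℓ : ℕ} {p : Fin (ℓ + 1) → V}
    {y : V} (h : IsFreshWalk Γ W (ℓ := ℓ + 1) (Fin.snoc p y : Fin (ℓ + 1 + 1) → V)) :
    IsFreshWalk Γ W p ∧ ((∃ b : Fin (ℓ + 1), p b = y ∧ ℓ + 1 ≤ b + W) ∨
      ((∀ b, p b ≠ y) ∧ Γ.Adj (p (Fin.last ℓ)) y)) := by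
  have hc : ∀ i : Fin (ℓ + 1), (Fin.snoc p y : Fin (ℓ + 1 + 1) → V) i.castSucc = p i :=
    fun i => Fin.snoc_castSucc _ _ _
  have hl : (Fin.snoc p y : Fin (ℓ + 1 + 1) → V) (Fin.last _) = y := Fin.snoc_last _ _
  refine ⟨⟨fun i => ?_, fun a b hab => ?_⟩, ?_⟩
  · have := h.step i.castSucc
    rwa [Fin.succ_castSucc, hc, hc] at this
  · have := h.fresh a.castSucc b.castSucc (by rw [hc, hc, hab])
    simpa using this
  · by_cases hy : ∃ b, p b = y
    · obtain ⟨b, hb⟩ := hy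
      refine Or.inl ⟨b, hb, ?_⟩
      have := h.fresh b.castSucc (Fin.last _) (by rw [hc, hl, hb])
      simpa using this
    · push Not at hy
      refine Or.inr ⟨hy, ?_⟩
      have := h.step (Fin.last ℓ)
      rw [Fin.succ_last, hc, hl] at this
      exact this.resolve_left (hy _).symm

theorem card_factorGraph_neighbors_inr_le (Φ : Formula k n m) (c : Fin m)
    [DecidablePred ((factorGraph Φ).skeleton.Adj (Sum.inr c))] :
    ((Finset.univ : Finset (FVertex n m)).filter
      ((factorGraph Φ).skeleton.Adj (Sum.inr c))).card ≤ k := by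
  classical
  calc _ ≤ (Finset.univ.image fun j : Fin k => (Sum.inl (Φ c j).1 : FVertex n m)).card := by
        refine Finset.card_le_card fun y hy => ?_
        rw [Finset.mem_filter] at hy
        have h := hy.2
        rcases y with y | d
        · obtain ⟨j, rfl⟩ := factorGraph_adj_inl_inr.1 h.symm
          exact Finset.mem_image_of_mem _ (Finset.mem_univ j)
        · exact absurd h factorGraph_not_adj_inr_inr
    _ ≤ k := Finset.card_image_le.trans (by simp)

open Classical in
/-- On average over the formulas, a fresh walk has at most `k + km/n` continuations to a new
vertex. -/
theorem sum_card_newNeighbor_le {W ℓ : ℕ} (p : Fin (ℓ + 1) → FVertex n m) :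
    n * ∑ y ∈ (Finset.univ : Finset (FVertex n m)).filter (fun y => ∀ b, p b ≠ y),
      ((freshFormulas k W p).filter fun Φ =>
        (factorGraph Φ).skeleton.Adj (p (Fin.last ℓ)) y).card ≤
      (n * k + m * k) * (freshFormulas k W p).card := by
  rcases hlast : p (Fin.last ℓ) with x | c
  · have h1 : ∀ y ∈ (Finset.univ : Finset (FVertex n m)).filter (fun y => ∀ b, p b ≠ y),
        n * ((freshFormulas k W p).filter fun Φ =>
          (factorGraph Φ).skeleton.Adj (Sum.inl x) y).card ≤
        Sum.elim (fun _ => 0) (fun _ => k * (freshFormulas k W p).card) y := by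
      intro y hy
      rw [Finset.mem_filter] at hy
      rcases y with y | c
      · simp only [Sum.elim_inl, Nat.le_zero, mul_eq_zero, Finset.card_eq_zero]
        exact Or.inr (Finset.filter_false_of_mem fun Φ _ => factorGraph_not_adj_inl_inl)
      · rw [Sum.elim_inr]
        calc _ ≤ n * ∑ j : Fin k, ((freshFormulas k W p).filter fun Φ => (Φ c j).1 = x).card := by
              refine Nat.mul_le_mul_left _ ?_
              refine le_trans (Finset.card_le_card ?_) Finset.card_biUnion_le
              intro Φ hΦ
              rw [Finset.mem_filter] at hΦ
              obtain ⟨j, hj⟩ := factorGraph_adj_inl_inr.1 hΦ.2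
              exact Finset.mem_biUnion.2 ⟨j, Finset.mem_univ _, Finset.mem_filter.2 ⟨hΦ.1, hj⟩⟩
          _ = k * (freshFormulas k W p).card := by
              rw [Finset.mul_sum, Finset.sum_congr rfl fun j _ => card_literal_eq _ c
                (fun Φ hΦ C => update_mem_freshFormulas hΦ hy.2 C) j x]
              simp
    calc _ = ∑ y ∈ (Finset.univ : Finset (FVertex n m)).filter (fun y => ∀ b, p b ≠ y),
          n * ((freshFormulas k W p).filter fun Φ =>
            (factorGraph Φ).skeleton.Adj (Sum.inl x) y).card := Finset.mul_sum _ _ _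
      _ ≤ ∑ y ∈ (Finset.univ : Finset (FVertex n m)).filter (fun y => ∀ b, p b ≠ y),
          Sum.elim (fun _ => 0) (fun _ => k * (freshFormulas k W p).card) y :=
          Finset.sum_le_sum h1
      _ ≤ ∑ y : FVertex n m,
          Sum.elim (fun _ => 0) (fun _ => k * (freshFormulas k W p).card) y :=
          Finset.sum_le_sum_of_subset (Finset.filter_subset _ _)
      _ = m * k * (freshFormulas k W p).card := by
          rw [Fintype.sum_sum_type]
          simp [mul_assoc]
      _ ≤ _ := Nat.mul_le_mul_right _ (Nat.le_add_left _ _)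
  · calc _ ≤ n * ∑ y : FVertex n m, ((freshFormulas k W p).filter fun Φ =>
          (factorGraph Φ).skeleton.Adj (Sum.inr c) y).card :=
          Nat.mul_le_mul_left _ (Finset.sum_le_sum_of_subset (Finset.filter_subset _ _))
      _ = n * ∑ Φ ∈ freshFormulas k W p, ((Finset.univ : Finset (FVertex n m)).filter
          ((factorGraph Φ).skeleton.Adj (Sum.inr c))).card := by
          simp only [Finset.card_filter]
          rw [Finset.sum_comm]
      _ ≤ n * ∑ Φ ∈ freshFormulas k W p, k :=
          Nat.mul_le_mul_left _ (Finset.sum_le_sum fun Φ _ =>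
            card_factorGraph_neighbors_inr_le Φ c)
      _ = n * k * (freshFormulas k W p).card := by
          rw [Finset.sum_const, smul_eq_mul]; ring
      _ ≤ _ := Nat.mul_le_mul_right _ (Nat.le_add_right _ _)

theorem sum_card_snoc_le {W ℓ : ℕ} (p : Fin (ℓ + 1) → FVertex n m) :
    n * ∑ y : FVertex n m,
      (freshFormulas k W (ℓ := ℓ + 1) (Fin.snoc p y : Fin (ℓ + 1 + 1) → FVertex n m)).card ≤
      (n * W + n * k + m * k) * (freshFormulas k W p).card := by
  classical
  -- The times of the last `W` vertices of the walk.
  let B : Finset (Fin (ℓ + 1)) := Finset.univ.filter fun b => ℓ + 1 ≤ b + W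
  have hB : B.card ≤ W := by
    have : B.card ≤ (Finset.Icc (ℓ + 1 - W) ℓ).card := by
      refine Finset.card_le_card_of_injOn (fun b => (b : ℕ)) ?_ (Fin.val_injective.injOn)
      intro b hb
      have hb := (Finset.mem_filter.1 hb).2
      simp only [Finset.coe_Icc, Set.mem_Icc]
      omega
    rw [Nat.card_Icc] at this
    omega
  have h1 : ∀ y : FVertex n m,
      (freshFormulas k W (ℓ := ℓ + 1) (Fin.snoc p y : Fin (ℓ + 1 + 1) → FVertex n m)).card ≤
      (if y ∈ B.image p then (freshFormulas k W p).card else 0) +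
      (if ∀ b, p b ≠ y then ((freshFormulas k W p).filter fun Φ =>
        (factorGraph Φ).skeleton.Adj (p (Fin.last ℓ)) y).card else 0) := by
    intro y
    by_cases hy : ∀ b, p b ≠ y
    · rw [if_pos hy]
      refine le_add_left (Finset.card_le_card fun Φ hΦ => ?_)
      rw [mem_freshFormulas] at hΦ
      obtain ⟨h1, ⟨b, hb, -⟩ | ⟨-, h2⟩⟩ := hΦ.snoc
      · exact absurd hb (hy b)
      · exact Finset.mem_filter.2 ⟨mem_freshFormulas.2 h1, h2⟩
    · by_cases hyB : y ∈ B.image p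
      · rw [if_pos hyB]
        refine le_add_right (Finset.card_le_card fun Φ hΦ => ?_)
        rw [mem_freshFormulas] at hΦ ⊢
        exact hΦ.snoc.1
      · rw [Finset.card_eq_zero.2]
        · exact Nat.zero_le _
        · refine Finset.eq_empty_of_forall_notMem fun Φ hΦ => ?_
          rw [mem_freshFormulas] at hΦ
          obtain ⟨h1, ⟨b, hb, hb'⟩ | ⟨h2, -⟩⟩ := hΦ.snoc
          · exact hyB (Finset.mem_image.2 ⟨b, Finset.mem_filter.2 ⟨Finset.mem_univ _, hb'⟩, hb⟩)
          · exact hy h2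
  calc _ ≤ n * ∑ y : FVertex n m, ((if y ∈ B.image p then (freshFormulas k W p).card else 0) +
      (if ∀ b, p b ≠ y then ((freshFormulas k W p).filter fun Φ =>
        (factorGraph Φ).skeleton.Adj (p (Fin.last ℓ)) y).card else 0)) :=
        Nat.mul_le_mul_left _ (Finset.sum_le_sum fun y _ => h1 y)
    _ = n * ((B.image p).card * (freshFormulas k W p).card) +
        n * ∑ y ∈ (Finset.univ : Finset (FVertex n m)).filter (fun y => ∀ b, p b ≠ y),
        ((freshFormulas k W p).filter fun Φ =>
          (factorGraph Φ).skeleton.Adj (p (Fin.last ℓ)) y).card := by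
        rw [Finset.sum_add_distrib, mul_add, Finset.sum_filter]
        congr 2
        rw [← Finset.sum_filter, Finset.filter_mem_eq_inter, Finset.univ_inter,
          Finset.sum_const, smul_eq_mul]
    _ ≤ n * (W * (freshFormulas k W p).card) + (n * k + m * k) * (freshFormulas k W p).card :=
        add_le_add (Nat.mul_le_mul_left _ (Nat.mul_le_mul_right _
          (Finset.card_image_le.trans hB))) (sum_card_newNeighbor_le p)
    _ = _ := by ring

/-- The expected number of fresh walks of length `ℓ` grows at most exponentially in `ℓ`, at a rate
which depends only on `k`, `W` and the clause density. -/
theorem pow_mul_sum_card_freshFormulas_le (W ℓ : ℕ) :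
    n ^ ℓ * ∑ p : Fin (ℓ + 1) → FVertex n m, (freshFormulas k W p).card ≤
      (n * W + n * k + m * k) ^ ℓ * ((n + m) * Fintype.card (Formula k n m)) := by
  induction ℓ with
  | zero =>
    rw [pow_zero, pow_zero, one_mul, one_mul]
    calc _ ≤ ∑ p : Fin (0 + 1) → FVertex n m, Fintype.card (Formula k n m) :=
          Finset.sum_le_sum fun p _ => Finset.card_le_univ _
      _ = _ := by simp
  | succ ℓ ih =>
    have h : ∑ p : Fin (ℓ + 1 + 1) → FVertex n m, (freshFormulas k W p).card =
        ∑ p : Fin (ℓ + 1) → FVertex n m, ∑ y : FVertex n m,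
          (freshFormulas k W (ℓ := ℓ + 1) (Fin.snoc p y : Fin (ℓ + 1 + 1) → FVertex n m)).card := by
      rw [← (Fin.snocEquiv fun _ : Fin (ℓ + 1 + 1) => FVertex n m).sum_comp,
        Fintype.sum_prod_type_right]
      rfl
    calc n ^ (ℓ + 1) * ∑ p : Fin (ℓ + 1 + 1) → FVertex n m, (freshFormulas k W p).card
        = n ^ ℓ * ∑ p : Fin (ℓ + 1) → FVertex n m, n * ∑ y : FVertex n m,
          (freshFormulas k W (ℓ := ℓ + 1)
            (Fin.snoc p y : Fin (ℓ + 1 + 1) → FVertex n m)).card := by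
          rw [h, ← Finset.mul_sum, pow_succ, mul_assoc]
      _ ≤ n ^ ℓ * ∑ p : Fin (ℓ + 1) → FVertex n m,
          (n * W + n * k + m * k) * (freshFormulas k W p).card :=
          Nat.mul_le_mul_left _ (Finset.sum_le_sum fun p _ => sum_card_snoc_le p)
      _ = (n * W + n * k + m * k) * (n ^ ℓ *
          ∑ p : Fin (ℓ + 1) → FVertex n m, (freshFormulas k W p).card) := by
          rw [← Finset.mul_sum]; ring
      _ ≤ _ := (Nat.mul_le_mul_left _ ih).trans (by rw [pow_succ]; exact le_of_eq (by ring))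

end Counting

/-! ### The order of independent processing times -/

section Order

variable {V X : Type*} [MeasurableSpace X] [LinearOrder X] [TopologicalSpace X]
  [OrderClosedTopology X] [SecondCountableTopology X] [OpensMeasurableSpace X]

theorem measurableSet_strictAnti_comp {L : ℕ} (w : Fin L → V) :
    MeasurableSet {ψ : V → X | StrictAnti (ψ ∘ w)} := by
  refine measurableSet_setOfPred.2 ?_
  refine Measurable.forall fun i => Measurable.forall fun j => Measurable.imp measurable_const ?_
  exact measurableSet_setOfPred.1
    (measurableSet_lt (measurable_pi_apply (w j)) (measurable_pi_apply (w i)))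

/-- The probability that `L` independent processing times come in a given order is at most `1 / L!`,
since all orders are equally likely. -/
theorem factorial_mul_strictAnti_le_one [Fintype V] (ν : Measure X)
    [IsProbabilityMeasure ν] {L : ℕ} (w : Fin L → V) :
    (L.factorial : ENNReal) *
      Measure.pi (fun _ : V => ν) {ψ | StrictAnti (ψ ∘ w)} ≤ 1 := by
  classical
  by_cases hw : Function.Injective w
  · let τ : Equiv.Perm (Fin L) → Equiv.Perm V := fun σ => σ.viaEmbedding ⟨w, hw⟩
    have hτ : ∀ σ i, τ σ (w i) = w (σ i) := fun σ i => σ.viaEmbedding_apply ⟨w, hw⟩ i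
    have hmeas : ∀ σ : Equiv.Perm (Fin L), Measure.pi (fun _ : V => ν)
        {ψ | StrictAnti (ψ ∘ w ∘ σ)} = Measure.pi (fun _ : V => ν) {ψ | StrictAnti (ψ ∘ w)} := by
      intro σ
      have h := (measurePreserving_piCongrLeft (fun _ : V => ν) (τ σ).symm).measure_preimage
        (measurableSet_strictAnti_comp w).nullMeasurableSet
      rw [← h]
      congr 1
      ext ψ
      have : (MeasurableEquiv.piCongrLeft (fun _ : V => X) (τ σ).symm ψ) ∘ w = ψ ∘ w ∘ σ := by
        funext i
        have h1 := MeasurableEquiv.piCongrLeft_apply_apply (β := fun _ : V => X)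
          (e := (τ σ).symm) (x := ψ) (i := w (σ i))
        simp only [← hτ, Equiv.symm_apply_apply] at h1
        simpa [← hτ] using h1
      simp only [Set.mem_preimage, Set.mem_ofPred_eq, this]
    have hdisj : Pairwise (Function.onFun Disjoint
        fun σ : Equiv.Perm (Fin L) => {ψ : V → X | StrictAnti (ψ ∘ w ∘ σ)}) := by
      intro σ σ' hne
      refine Set.disjoint_left.2 fun ψ h h' => hne ?_
      have h1 : ψ ∘ w ∘ σ = ψ ∘ w ∘ σ' := by
        have : StrictMono (OrderDual.toDual ∘ ψ ∘ w ∘ σ) := fun i j hij => h hij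
        have this' : StrictMono (OrderDual.toDual ∘ ψ ∘ w ∘ σ') := fun i j hij => h' hij
        have := (StrictMono.range_inj this this').1 (by
          rw [← Function.comp_assoc, ← Function.comp_assoc, ← Function.comp_assoc,
            ← Function.comp_assoc, σ.surjective.range_comp, σ'.surjective.range_comp])
        exact this
      ext i
      have h2 := congrFun h1 i
      have hinj : Function.Injective (ψ ∘ w) := by
        have := h.injective
        rw [← Function.comp_assoc] at this
        exact (Function.Injective.of_comp_iff' _ σ.bijective).1 this
      exact congrArg _ (hinj h2)
    calc _ = ∑ σ : Equiv.Perm (Fin L), Measure.pi (fun _ : V => ν)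
          {ψ | StrictAnti (ψ ∘ w ∘ σ)} := by
          rw [Finset.sum_congr rfl fun σ _ => hmeas σ, Finset.sum_const, Finset.card_univ,
            Fintype.card_perm, Fintype.card_fin, nsmul_eq_mul]
      _ = Measure.pi (fun _ : V => ν) (⋃ σ : Equiv.Perm (Fin L),
          {ψ | StrictAnti (ψ ∘ w ∘ σ)}) := by
          rw [measure_iUnion hdisj fun σ => measurableSet_strictAnti_comp (w ∘ σ), tsum_fintype]
      _ ≤ 1 := prob_le_one
  · have : {ψ : V → X | StrictAnti (ψ ∘ w)} = ∅ := by
      ext ψ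
      simp only [Set.mem_ofPred_eq, Set.mem_empty_iff_false, iff_false]
      exact fun h => hw h.injective.of_comp
    rw [this]
    simp

theorem ae_injective_pi [Fintype V] (ν : Measure X) [IsProbabilityMeasure ν]
    [NullSingletonClass ν] :
    ∀ᵐ ψ ∂(Measure.pi fun _ : V => ν), Function.Injective ψ := by
  have h : ∀ x y : V, x ≠ y → ∀ᵐ ψ ∂(Measure.pi fun _ : V => ν), ψ x ≠ ψ y := by
    intro x y hxy
    have hind : ProbabilityTheory.IndepFun (fun ψ : V → X => ψ x) (fun ψ : V → X => ψ y)
        (Measure.pi fun _ : V => ν) :=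
      (ProbabilityTheory.iIndepFun_pi (X := fun _ : V => (id : X → X))
        (μ := fun _ => ν) fun _ => aemeasurable_id).indepFun hxy
    have hmap := (ProbabilityTheory.indepFun_iff_map_prod_eq_prod_map_map
      (measurable_pi_apply x).aemeasurable (measurable_pi_apply y).aemeasurable).1 hind
    have hx := (measurePreserving_eval (α := fun _ : V => X) (fun _ : V => ν) x).map_eq
    have hy := (measurePreserving_eval (α := fun _ : V => X) (fun _ : V => ν) y).map_eq
    have hdiag : MeasurableSet {p : X × X | p.1 = p.2} :=
      measurableSet_eq_fun measurable_fst measurable_snd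
    have h0 : (ν.prod ν) {p : X × X | p.1 = p.2} = 0 := by
      rw [Measure.prod_apply hdiag]
      refine (lintegral_congr fun a => ?_).trans lintegral_zero
      have : Prod.mk a ⁻¹' {p : X × X | p.1 = p.2} = {a} := by
        ext b
        simp [eq_comm]
      rw [this]
      exact measure_singleton a
    have h1 : Measure.map (fun ψ : V → X => (ψ x, ψ y)) (Measure.pi fun _ : V => ν)
        {p : X × X | p.1 = p.2} = 0 := by
      rw [hmap]
      change (Measure.map (fun ψ : V → X => ψ x) _).prod
        (Measure.map (fun ψ : V → X => ψ y) _) _ = 0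
      rw [hx, hy, h0]
    rw [Measure.map_apply ((measurable_pi_apply x).prodMk (measurable_pi_apply y)) hdiag] at h1
    rw [ae_iff]
    convert h1 using 2
    ext ψ
    simp
  have h' : ∀ᵐ ψ ∂(Measure.pi fun _ : V => ν), ∀ x y : V, x ≠ y → ψ x ≠ ψ y :=
    ae_all_iff.2 fun x => ae_all_iff.2 fun y => by
      by_cases hxy : x = y
      · exact Filter.Eventually.of_forall fun _ h => absurd hxy h
      · filter_upwards [h x y hxy] with ψ hψ _ using hψ
  filter_upwards [h'] with ψ hψ x y hxy
  by_contra hne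
  exact hψ x y hne hxy

end Order

/-! ### The bounded difference inequality -/

section BoundedDifferences

/-- Bounds on the exponential moments of the sections of `f` and of the mean of the sections
combine to a bound on the exponential moment of `f`. -/
theorem integral_exp_prod_le {A B : Type*} [MeasurableSpace A] [MeasurableSpace B]
    {μ : Measure A} {ν : Measure B} [IsProbabilityMeasure μ] [IsProbabilityMeasure ν]
    {f : A × B → ℝ} (hf : Measurable f) {M : ℝ} (hM : ∀ p, |f p| ≤ M) (θ s t : ℝ)
    (h1 : ∀ b, ∫ a, Real.exp (θ * f (a, b)) ∂μ ≤ Real.exp (θ * (∫ a, f (a, b) ∂μ) + s))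
    (h2 : ∫ b, Real.exp (θ * ∫ a, f (a, b) ∂μ) ∂ν ≤
      Real.exp (θ * (∫ b, ∫ a, f (a, b) ∂μ ∂ν) + t)) :
    ∫ p, Real.exp (θ * f p) ∂(μ.prod ν) ≤ Real.exp (θ * (∫ p, f p ∂(μ.prod ν)) + (s + t)) := by
  have hbdd : ∀ x : ℝ, |x| ≤ M → |Real.exp (θ * x)| ≤ Real.exp (|θ| * M) := by
    intro x hx
    rw [Real.abs_exp, Real.exp_le_exp]
    refine (le_abs_self _).trans ?_
    rw [abs_mul]
    exact mul_le_mul_of_nonneg_left hx (abs_nonneg θ)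
  have hfi : Integrable f (μ.prod ν) :=
    Integrable.of_bound hf.aestronglyMeasurable M (Filter.Eventually.of_forall hM)
  have hei : Integrable (fun p => Real.exp (θ * f p)) (μ.prod ν) :=
    Integrable.of_bound (by fun_prop) (Real.exp (|θ| * M))
      (Filter.Eventually.of_forall fun p => hbdd _ (hM p))
  have hg : StronglyMeasurable fun b => ∫ a, f (a, b) ∂μ :=
    hf.stronglyMeasurable.integral_prod_left'
  have hgM : ∀ b, |∫ a, f (a, b) ∂μ| ≤ M := by
    intro b
    have := norm_integral_le_of_norm_le_const (μ := μ) (f := fun a => f (a, b)) (C := M)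
      (Filter.Eventually.of_forall fun a => hM (a, b))
    simpa using this
  have hgi : Integrable (fun b => Real.exp (θ * ∫ a, f (a, b) ∂μ)) ν :=
    Integrable.of_bound
      ((Real.continuous_exp.measurable.comp (hg.measurable.const_mul θ)).aestronglyMeasurable)
      (Real.exp (|θ| * M)) (Filter.Eventually.of_forall fun b => hbdd _ (hgM b))
  rw [integral_prod_symm _ hei, integral_prod_symm _ hfi]
  calc ∫ b, ∫ a, Real.exp (θ * f (a, b)) ∂μ ∂ν
      ≤ ∫ b, Real.exp (θ * ∫ a, f (a, b) ∂μ) * Real.exp s ∂ν := by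
        refine integral_mono hei.integral_prod_right (hgi.mul_const _) fun b => ?_
        rw [← Real.exp_add]
        exact h1 b
    _ = (∫ b, Real.exp (θ * ∫ a, f (a, b) ∂μ) ∂ν) * Real.exp s := integral_mul_const _ _
    _ ≤ Real.exp (θ * (∫ b, ∫ a, f (a, b) ∂μ ∂ν) + t) * Real.exp s :=
        mul_le_mul_of_nonneg_right h2 (Real.exp_nonneg _)
    _ = _ := by rw [← Real.exp_add]; congr 1; ring

variable {X : Type*} [MeasurableSpace X] (ν : Measure X) [IsProbabilityMeasure ν]

/-- Hoeffding's lemma for a function with oscillation at most `c`. -/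
theorem integral_exp_le_of_oscillation {f : X → ℝ} (hf : Measurable f) {c : ℝ}
    (hc : ∀ x y, |f x - f y| ≤ c) (θ : ℝ) :
    ∫ x, Real.exp (θ * f x) ∂ν ≤ Real.exp (θ * (∫ x, f x ∂ν) + c ^ 2 * θ ^ 2 / 2) := by
  obtain ⟨x₀⟩ : Nonempty X := nonempty_of_isProbabilityMeasure ν
  have hb : ∀ᵐ x ∂ν, f x ∈ Set.Icc (f x₀ - c) (f x₀ + c) := by
    refine Filter.Eventually.of_forall fun x => ?_
    have := abs_le.1 (hc x x₀)
    exact ⟨by linarith, by linarith⟩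
  have h := (ProbabilityTheory.hasSubgaussianMGF_of_mem_Icc hf.aemeasurable hb).mgf_le θ
  have hc0 : 0 ≤ c := (abs_nonneg _).trans (hc x₀ x₀)
  have he : ((‖f x₀ + c - (f x₀ - c)‖₊ / 2 : NNReal) ^ 2 : NNReal) = c ^ 2 := by
    push_cast
    rw [Real.norm_eq_abs, show f x₀ + c - (f x₀ - c) = 2 * c by ring,
      abs_of_nonneg (by positivity)]
    ring
  rw [he, ProbabilityTheory.mgf] at h
  calc ∫ x, Real.exp (θ * f x) ∂ν
      = ∫ x, Real.exp (θ * ∫ x, f x ∂ν) * Real.exp (θ * (f x - ∫ x, f x ∂ν)) ∂ν := by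
        refine integral_congr_ae (Filter.Eventually.of_forall fun x => ?_)
        dsimp only
        rw [← Real.exp_add]
        congr 1
        ring
    _ = Real.exp (θ * ∫ x, f x ∂ν) * ∫ x, Real.exp (θ * (f x - ∫ x, f x ∂ν)) ∂ν :=
        integral_const_mul _ _
    _ ≤ _ := by
        rw [Real.exp_add]
        exact mul_le_mul_of_nonneg_left h (Real.exp_nonneg _)

theorem integral_exp_pi_fin_le {N : ℕ} {f : (Fin N → X) → ℝ} (hf : Measurable f) {M c : ℝ}
    (hM : ∀ x, |f x| ≤ M) (hc : ∀ x i a, |f (Function.update x i a) - f x| ≤ c) (θ : ℝ) :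
    ∫ x, Real.exp (θ * f x) ∂(Measure.pi fun _ => ν) ≤
      Real.exp (θ * (∫ x, f x ∂(Measure.pi fun _ => ν)) + N * (c ^ 2 * θ ^ 2 / 2)) := by
  induction N with
  | zero =>
    have h : ∀ x, f x = f (fun i => i.elim0) := fun x => congrArg f (Subsingleton.elim _ _)
    simp [h]
  | succ N ih =>
    have hmp := (measurePreserving_piFinSuccAbove (fun _ : Fin (N + 1) => ν) 0).symm
    have hcons : ∀ a b, (MeasurableEquiv.piFinSuccAbove (fun _ : Fin (N + 1) => X) 0).symm (a, b) =
        (Fin.cons a b : Fin (N + 1) → X) := fun a b => by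
      simp [MeasurableEquiv.piFinSuccAbove, Fin.insertNthEquiv]
    let e := (MeasurableEquiv.piFinSuccAbove (fun _ : Fin (N + 1) => X) 0).symm
    have hf' : Measurable fun p : X × (Fin N → X) => f (e p) := hf.comp e.measurable
    have hupd0 : ∀ a a' b, e (a, b) = Function.update (e (a', b)) 0 a := by
      intro a a' b
      rw [hcons, hcons, Fin.update_cons_zero]
    have hupd : ∀ a b i x, e (a, Function.update b i x) = Function.update (e (a, b)) i.succ x := by
      intro a b i x
      rw [hcons, hcons, Fin.cons_update]
    have hsec : ∀ b, Integrable (fun a => f (e (a, b))) ν := fun b =>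
      Integrable.of_bound (hf'.comp measurable_prodMk_right).aestronglyMeasurable M
        (Filter.Eventually.of_forall fun a => hM _)
    have hg : Measurable fun b => ∫ a, f (e (a, b)) ∂ν :=
      (hf'.stronglyMeasurable.integral_prod_left').measurable
    have hgM : ∀ b, |∫ a, f (e (a, b)) ∂ν| ≤ M := by
      intro b
      have := norm_integral_le_of_norm_le_const (μ := ν) (f := fun a => f (e (a, b))) (C := M)
        (Filter.Eventually.of_forall fun a => hM _)
      simpa using this
    have hgc : ∀ b i x, |∫ a, f (e (a, Function.update b i x)) ∂ν - ∫ a, f (e (a, b)) ∂ν| ≤ c := by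
      intro b i x
      rw [← integral_sub (hsec _) (hsec _)]
      have := norm_integral_le_of_norm_le_const (μ := ν)
        (f := fun a => f (e (a, Function.update b i x)) - f (e (a, b))) (C := c)
        (Filter.Eventually.of_forall fun a => by
          rw [hupd]
          exact hc _ _ _)
      simpa using this
    have h := integral_exp_prod_le (μ := ν) (ν := Measure.pi fun _ : Fin N => ν) hf'
      (fun p => hM _) θ (c ^ 2 * θ ^ 2 / 2) (N * (c ^ 2 * θ ^ 2 / 2))
      (fun b => integral_exp_le_of_oscillation ν (hf'.comp measurable_prodMk_right)
        (fun a a' => by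
          simp only [Function.comp]
          rw [hupd0 a a' b]
          exact hc _ _ _) θ)
      (ih hg hgM hgc)
    rw [hmp.integral_comp' (fun x => Real.exp (θ * f x)), hmp.integral_comp' f] at h
    refine h.trans_eq ?_
    push_cast
    congr 1
    ring

/-- **Bounded difference inequality**, in the form of a bound on the exponential moments: a function
of independent variables, which changes by at most `c` when one variable is changed, is
sub-Gaussian. -/
theorem integral_exp_pi_le {ι : Type*} [Fintype ι] [DecidableEq ι] {f : (ι → X) → ℝ}
    (hf : Measurable f) {M c : ℝ} (hM : ∀ x, |f x| ≤ M)
    (hc : ∀ x i a, |f (Function.update x i a) - f x| ≤ c) (θ : ℝ) :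
    ∫ x, Real.exp (θ * f x) ∂(Measure.pi fun _ => ν) ≤
      Real.exp (θ * (∫ x, f x ∂(Measure.pi fun _ => ν)) +
        Fintype.card ι * (c ^ 2 * θ ^ 2 / 2)) := by
  let σ := (Fintype.equivFin ι).symm
  have hmp := measurePreserving_piCongrLeft (α := fun _ : ι => X) (fun _ => ν) σ
  let e := MeasurableEquiv.piCongrLeft (fun _ : ι => X) σ
  have he : ∀ x i, e x (σ i) = x i := fun x i =>
    MeasurableEquiv.piCongrLeft_apply_apply (β := fun _ : ι => X) (e := σ) (x := x) (i := i)
  have h := integral_exp_pi_fin_le ν (f := fun x => f (e x)) (hf.comp e.measurable)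
    (fun x => hM _) (c := c) (fun x i a => by
      have : e (Function.update x i a) = Function.update (e x) (σ i) a := by
        funext j
        obtain ⟨j, rfl⟩ := σ.surjective j
        rw [he]
        by_cases hij : j = i
        · subst hij
          simp
        · rw [Function.update_of_ne hij, Function.update_of_ne (σ.injective.ne hij), he]
      rw [this]
      exact hc _ _ _) θ
  rwa [hmp.integral_comp' (fun x => Real.exp (θ * f x)), hmp.integral_comp' f] at h

/-- The tail bound that follows from a bound on the exponential moment. -/
theorem measure_ge_le_of_integral_exp_le {A : Type*} [MeasurableSpace A] {μ : Measure A}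
    [IsProbabilityMeasure μ] {f : A → ℝ} (hf : Measurable f) {M : ℝ} (hM : ∀ x, |f x| ≤ M)
    {θ s b : ℝ} (hθ : 0 ≤ θ) (h : ∫ x, Real.exp (θ * f x) ∂μ ≤ Real.exp s) :
    μ {x | b ≤ f x} ≤ ENNReal.ofReal (Real.exp (s - θ * b)) := by
  have hi : Integrable (fun x => Real.exp (θ * f x)) μ := by
    refine Integrable.of_bound (by fun_prop) (Real.exp (|θ| * M))
      (Filter.Eventually.of_forall fun x => ?_)
    rw [Real.norm_eq_abs, Real.abs_exp, Real.exp_le_exp]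
    refine (le_abs_self _).trans ?_
    rw [abs_mul]
    exact mul_le_mul_of_nonneg_left (hM x) (abs_nonneg θ)
  have h1 := ProbabilityTheory.measure_ge_le_exp_mul_mgf b hθ hi
  rw [← ofReal_measureReal]
  refine ENNReal.ofReal_le_ofReal (h1.trans ?_)
  rw [Real.exp_sub, div_eq_mul_inv, ← Real.exp_neg, mul_comm]
  rw [neg_mul]
  exact mul_le_mul_of_nonneg_right h (Real.exp_nonneg _)

end BoundedDifferences

/-! ### Vertices close to a variable of high degree -/

section Reach

variable {V : Type*} [Fintype V]

open Classical in
/-- The vertices reached from `S` in at most `t` steps of the graph, each step leading to a vertex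
which satisfies `P`. -/
noncomputable def reach (Γ : SimpleGraph V) (P : V → Prop) (S : Finset V) : ℕ → Finset V
  | 0 => S
  | t + 1 => reach Γ P S t ∪ Finset.univ.filter fun u => P u ∧ ∃ a ∈ reach Γ P S t, Γ.Adj a u

theorem reach_mono (Γ : SimpleGraph V) (P : V → Prop) (S : Finset V) : Monotone (reach Γ P S) := by
  classical
  exact monotone_nat_of_le_succ fun t => Finset.subset_union_left

theorem forall_mem_reach {Γ : SimpleGraph V} {P : V → Prop} {S : Finset V} (hS : ∀ u ∈ S, P u)
    (t : ℕ) : ∀ u ∈ reach Γ P S t, P u := by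
  classical
  induction t with
  | zero => exact hS
  | succ t ih =>
    intro u hu
    rcases Finset.mem_union.1 hu with hu | hu
    · exact ih u hu
    · exact (Finset.mem_filter.1 hu).2.1

open Classical in
theorem card_reach_succ_le (Γ : SimpleGraph V) (P : V → Prop) (S : Finset V) (t : ℕ) :
    (reach Γ P S (t + 1)).card ≤ (reach Γ P S t).card +
      ∑ a ∈ reach Γ P S t, (Finset.univ.filter (Γ.Adj a)).card := by
  refine (Finset.card_union_le _ _).trans (Nat.add_le_add_left ?_ _)
  refine le_trans (Finset.card_le_card ?_) Finset.card_biUnion_le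
  intro u hu
  obtain ⟨-, a, ha, hau⟩ := (Finset.mem_filter.1 hu).2
  exact Finset.mem_biUnion.2 ⟨a, ha, Finset.mem_filter.2 ⟨Finset.mem_univ _, hau⟩⟩

/-- The start of a walk which meets `S` is within reach of `S`. -/
theorem IsFreshWalk.mem_reach {Γ : SimpleGraph V} {W ℓ : ℕ} {p : Fin (ℓ + 1) → V}
    (hp : IsFreshWalk Γ W p) {P : V → Prop} (hP : ∀ i, P (p i)) {S : Finset V}
    {i : Fin (ℓ + 1)} (hi : p i ∈ S) : p 0 ∈ reach Γ P S ℓ := by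
  classical
  have h : ∀ i s, p i ∈ reach Γ P S s → p 0 ∈ reach Γ P S (s + i) := by
    intro i
    induction i using Fin.induction with
    | zero => exact fun s hs => hs
    | succ i ih =>
      intro s hs
      have h1 : p i.castSucc ∈ reach Γ P S (s + 1) := by
        rcases hp.step i with h | h
        · rw [← h]
          exact reach_mono Γ P S (Nat.le_succ s) hs
        · exact Finset.mem_union_right _
            (Finset.mem_filter.2 ⟨Finset.mem_univ _, hP _, _, hs, h.symm⟩)
      have h2 := ih (s + 1) h1
      rw [Fin.val_castSucc] at h2
      rwa [Fin.val_succ, show s + (i + 1) = s + 1 + (i : ℕ) by omega]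
  exact reach_mono Γ P S (by have := i.2; omega) (h i 0 hi)

end Reach

section Degrees

variable {k n m : ℕ}

/-- The degree of a variable: the number of literals in which it occurs. -/
def varDegree (Φ : Formula k n m) (x : Fin n) : ℕ :=
  (Finset.univ.filter fun e : Fin m × Fin k => (Φ e.1 e.2).1 = x).card

/-- The number of literals whose variable has degree more than `D`. -/
def heavyDegree (Φ : Formula k n m) (D : ℕ) : ℕ :=
  ∑ x, if D < varDegree Φ x then varDegree Φ x else 0

theorem sum_varDegree (Φ : Formula k n m) (S : Finset (Fin n)) :
    ∑ x ∈ S, varDegree Φ x =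
      (Finset.univ.filter fun e : Fin m × Fin k => (Φ e.1 e.2).1 ∈ S).card := by
  rw [Finset.card_eq_sum_card_fiberwise (f := fun e : Fin m × Fin k => (Φ e.1 e.2).1) (t := S)
    (fun e he => by simpa using he)]
  refine Finset.sum_congr rfl fun x hx => ?_
  rw [varDegree, Finset.filter_filter]
  congr 1
  ext e
  simp only [Finset.mem_filter, Finset.mem_univ, true_and]
  exact ⟨fun h => ⟨by rwa [h], h⟩, fun h => h.2⟩

theorem mul_card_high_le (Φ : Formula k n m) (D : ℕ) :
    D * (Finset.univ.filter fun x => D < varDegree Φ x).card ≤ m * k := by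
  calc _ ≤ ∑ x ∈ Finset.univ.filter (fun x => D < varDegree Φ x), varDegree Φ x := by
        rw [mul_comm, ← smul_eq_mul]
        exact Finset.card_nsmul_le_sum _ _ _ fun x hx => (Finset.mem_filter.1 hx).2.le
    _ ≤ _ := by
        rw [sum_varDegree]
        exact (Finset.card_le_univ _).trans (by simp)

/-- The number of formulas in which the literals in `Q` have their variables in `S`. -/
theorem pow_mul_card_literals_mem (S : Finset (Fin n)) (Q : Finset (Fin m × Fin k)) :
    n ^ Q.card * (Finset.univ.filter fun Φ : Formula k n m =>
      ∀ e ∈ Q, (Φ e.1 e.2).1 ∈ S).card = S.card ^ Q.card * Fintype.card (Formula k n m) := by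
  classical
  have h1 : (Finset.univ.filter fun Φ : Formula k n m => ∀ e ∈ Q, (Φ e.1 e.2).1 ∈ S) =
      Fintype.piFinset fun c : Fin m => Fintype.piFinset fun j : Fin k =>
        if (c, j) ∈ Q then S ×ˢ (Finset.univ : Finset Bool) else Finset.univ := by
    ext Φ
    simp only [Finset.mem_filter, Finset.mem_univ, true_and, Fintype.mem_piFinset]
    constructor
    · intro h c j
      split_ifs with hcj
      · exact Finset.mem_product.2 ⟨h _ hcj, Finset.mem_univ _⟩
      · exact Finset.mem_univ _
    · intro h e he
      have := h e.1 e.2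
      rw [if_pos he] at this
      exact (Finset.mem_product.1 this).1
  have hpow : ∀ a : ℕ, ∏ e : Fin m × Fin k, (if e ∈ Q then a else 1) = a ^ Q.card := by
    intro a
    rw [Finset.prod_ite_mem, Finset.univ_inter, Finset.prod_const]
  have hF : Fintype.card (Formula k n m) = ∏ e : Fin m × Fin k, n * 2 := by
    simp [pow_mul, pow_right_comm]
  rw [h1, hF, ← hpow, ← hpow]
  simp only [Fintype.card_piFinset]
  rw [← Fintype.prod_prod_type' (f := fun (c : Fin m) (j : Fin k) =>
    (if (c, j) ∈ Q then S ×ˢ (Finset.univ : Finset Bool) else Finset.univ).card),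
    ← Finset.prod_mul_distrib, ← Finset.prod_mul_distrib]
  refine Finset.prod_congr rfl fun e _ => ?_
  split_ifs <;> simp [mul_left_comm]

/-- For a large degree bound `D`, all but a fraction `2⁻ⁿ` of the formulas have at most `δn`
literals with variables of degree more than `D`. The reason is a union bound over the possible sets
of these variables and of these literals. -/
theorem exists_card_heavyDegree_le {κ δ : ℝ} (hκ : 0 < κ) (hδ : 0 < δ) :
    ∃ D : ℕ, ∀ n m : ℕ, (m * k : ℝ) ≤ κ * n →
      2 ^ n * (Finset.univ.filter fun Φ : Formula k n m => δ * n < heavyDegree Φ D).card ≤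
        Fintype.card (Formula k n m) := by
  classical
  -- With this `B`, a pair `(S, Q)` has probability at most `2 ^ (-B |Q|) ≤ 2 ^ (-2n - mk)`, which
  -- beats the number `2 ^ (n + mk)` of pairs.
  obtain ⟨B, hB⟩ := exists_nat_ge ((2 + κ) / δ)
  obtain ⟨D, hD⟩ := exists_nat_ge (κ * 2 ^ B)
  refine ⟨D, fun n m hm => ?_⟩
  rcases Nat.eq_zero_or_pos n with rfl | hn
  · rw [pow_zero, one_mul]
    exact Finset.card_le_univ _
  have hn' : (0 : ℝ) < n := by exact_mod_cast hn
  rw [div_le_iff₀ hδ] at hB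
  let I : Finset (Finset (Fin n) × Finset (Fin m × Fin k)) :=
    Finset.univ.filter fun p => 2 ^ B * p.1.card ≤ n ∧ 2 * n + m * k ≤ B * p.2.card
  let E : Finset (Fin n) × Finset (Fin m × Fin k) → Finset (Formula k n m) := fun p =>
    Finset.univ.filter fun Φ => ∀ e ∈ p.2, (Φ e.1 e.2).1 ∈ p.1
  have hsub : (Finset.univ.filter fun Φ : Formula k n m => δ * n < heavyDegree Φ D) ⊆
      I.biUnion E := by
    intro Φ hΦ
    replace hΦ := (Finset.mem_filter.1 hΦ).2
    set S := Finset.univ.filter fun x => D < varDegree Φ x with hS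
    set Q := Finset.univ.filter fun e : Fin m × Fin k => (Φ e.1 e.2).1 ∈ S with hQ
    have hQc : heavyDegree Φ D = Q.card := by
      rw [hQ, ← sum_varDegree, hS, Finset.sum_filter]
      rfl
    refine Finset.mem_biUnion.2 ⟨(S, Q), Finset.mem_filter.2 ⟨Finset.mem_univ _, ?_, ?_⟩,
      Finset.mem_filter.2 ⟨Finset.mem_univ _, fun e he => (Finset.mem_filter.1 he).2⟩⟩
    · have h1 : (D * S.card : ℝ) ≤ m * k := by exact_mod_cast mul_card_high_le Φ D
      have h2 : κ * (2 ^ B * S.card) ≤ κ * n := by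
        calc κ * (2 ^ B * S.card) = κ * 2 ^ B * S.card := by ring
          _ ≤ D * S.card := mul_le_mul_of_nonneg_right hD (Nat.cast_nonneg _)
          _ ≤ κ * n := h1.trans hm
      have h3 := le_of_mul_le_mul_left h2 hκ
      exact_mod_cast h3
    · rw [hQc] at hΦ
      have h1 : ((2 * n + m * k : ℕ) : ℝ) ≤ (B * Q.card : ℕ) := by
        push_cast
        calc (2 * n + m * k : ℝ) ≤ (2 + κ) * n := by linarith
          _ ≤ B * δ * n := mul_le_mul_of_nonneg_right hB hn'.le
          _ = B * (δ * n) := by ring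
          _ ≤ B * Q.card := mul_le_mul_of_nonneg_left hΦ.le (Nat.cast_nonneg _)
      exact_mod_cast h1
  have hE : ∀ p ∈ I, 2 ^ (2 * n + m * k) * (E p).card ≤ Fintype.card (Formula k n m) := by
    rintro ⟨S, Q⟩ hp
    obtain ⟨h1, h2⟩ := (Finset.mem_filter.1 hp).2
    dsimp only at h1 h2
    have h3 := pow_mul_card_literals_mem S Q
    have h4 : n ^ Q.card * (2 ^ (2 * n + m * k) * (E (S, Q)).card) ≤
        n ^ Q.card * Fintype.card (Formula k n m) := by
      calc n ^ Q.card * (2 ^ (2 * n + m * k) * (E (S, Q)).card)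
          = 2 ^ (2 * n + m * k) * (n ^ Q.card * (E (S, Q)).card) := by ring
        _ = 2 ^ (2 * n + m * k) * (S.card ^ Q.card * Fintype.card (Formula k n m)) := by
            rw [← h3]
        _ ≤ 2 ^ (B * Q.card) * (S.card ^ Q.card * Fintype.card (Formula k n m)) :=
            Nat.mul_le_mul_right _ (Nat.pow_le_pow_right (by norm_num) h2)
        _ = (2 ^ B * S.card) ^ Q.card * Fintype.card (Formula k n m) := by
            rw [mul_pow, ← pow_mul]; ring
        _ ≤ n ^ Q.card * Fintype.card (Formula k n m) :=
            Nat.mul_le_mul_right _ (Nat.pow_le_pow_left h1 _)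
    exact Nat.le_of_mul_le_mul_left h4 (pow_pos hn _)
  have hI : I.card ≤ 2 ^ (n + m * k) := by
    refine (Finset.card_le_univ _).trans_eq ?_
    simp [pow_add]
  have h5 : 2 ^ (n + m * k) * (2 ^ n *
      (Finset.univ.filter fun Φ : Formula k n m => δ * n < heavyDegree Φ D).card) ≤
      2 ^ (n + m * k) * Fintype.card (Formula k n m) := by
    calc _ ≤ 2 ^ (n + m * k) * (2 ^ n * ∑ p ∈ I, (E p).card) := by
          gcongr
          exact (Finset.card_le_card hsub).trans Finset.card_biUnion_le
      _ = ∑ p ∈ I, 2 ^ (2 * n + m * k) * (E p).card := by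
          rw [← Finset.mul_sum, ← mul_assoc, ← pow_add]
          congr 2
          ring
      _ ≤ ∑ p ∈ I, Fintype.card (Formula k n m) := Finset.sum_le_sum hE
      _ = I.card * Fintype.card (Formula k n m) := by rw [Finset.sum_const, smul_eq_mul]
      _ ≤ _ := Nat.mul_le_mul_right _ hI
  exact Nat.le_of_mul_le_mul_left h5 (by positivity)

open Classical in
theorem card_factorGraph_neighbors_inl_le (Φ : Formula k n m) (x : Fin n) :
    ((Finset.univ : Finset (FVertex n m)).filter
      ((factorGraph Φ).skeleton.Adj (Sum.inl x))).card ≤ varDegree Φ x := by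
  calc _ ≤ ((Finset.univ.filter fun e : Fin m × Fin k => (Φ e.1 e.2).1 = x).image
        fun e => (Sum.inr e.1 : FVertex n m)).card := by
        refine Finset.card_le_card fun y hy => ?_
        have h := (Finset.mem_filter.1 hy).2
        rcases y with y | c
        · exact absurd h factorGraph_not_adj_inl_inl
        · obtain ⟨j, hj⟩ := factorGraph_adj_inl_inr.1 h
          exact Finset.mem_image.2 ⟨(c, j), Finset.mem_filter.2 ⟨Finset.mem_univ _, hj⟩, rfl⟩
    _ ≤ _ := Finset.card_image_le

/-- The variables of degree more than `D`, as vertices of the factor graph. -/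
def highVertices (Φ : Formula k n m) (D : ℕ) : Finset (FVertex n m) :=
  (Finset.univ.filter fun x => D < varDegree Φ x).map ⟨Sum.inl, Sum.inl_injective⟩

theorem card_reach_succ_le_heavyDegree (Φ : Formula k n m) (P : FVertex n m → Prop)
    (S : Finset (FVertex n m)) (t D : ℕ) :
    (reach (factorGraph Φ).skeleton P S (t + 1)).card ≤
      (1 + k + D) * (reach (factorGraph Φ).skeleton P S t).card + heavyDegree Φ D := by
  classical
  set A := reach (factorGraph Φ).skeleton P S t
  let g : FVertex n m → ℕ :=
    Sum.elim (fun x => if D < varDegree Φ x then varDegree Φ x else 0) fun _ => 0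
  have h1 : ∀ a : FVertex n m, ((Finset.univ : Finset (FVertex n m)).filter
      ((factorGraph Φ).skeleton.Adj a)).card ≤ (k + D) + g a := by
    rintro (x | c)
    · refine (card_factorGraph_neighbors_inl_le Φ x).trans ?_
      simp only [g, Sum.elim_inl]
      split_ifs <;> omega
    · refine (card_factorGraph_neighbors_inr_le Φ c).trans ?_
      omega
  have h2 : ∑ a ∈ A, g a ≤ heavyDegree Φ D := by
    refine (Finset.sum_le_univ_sum_of_nonneg fun _ => Nat.zero_le _).trans_eq ?_
    rw [Fintype.sum_sum_type]
    simp [g, heavyDegree]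
  calc _ ≤ A.card + ∑ a ∈ A, ((Finset.univ : Finset (FVertex n m)).filter
        ((factorGraph Φ).skeleton.Adj a)).card := card_reach_succ_le _ _ _ _
    _ ≤ A.card + ∑ a ∈ A, ((k + D) + g a) := Nat.add_le_add_left
        (Finset.sum_le_sum fun a _ => h1 a) _
    _ ≤ A.card + (A.card * (k + D) + heavyDegree Φ D) := by
        rw [Finset.sum_add_distrib, Finset.sum_const, smul_eq_mul]
        gcongr
    _ = _ := by ring

/-- For a large degree bound `D`, in all but a fraction `t 2⁻ⁿ` of the formulas at most `εn`
vertices are within distance `t` of a variable of degree more than `D`. -/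
theorem exists_card_reach_highVertices_le {κ : ℝ} (hκ : 0 < κ) (t : ℕ) {ε : ℝ} (hε : 0 < ε) :
    ∃ D : ℕ, ∀ n m : ℕ, (m * k : ℝ) ≤ κ * n →
      2 ^ n * (Finset.univ.filter fun Φ : Formula k n m => ε * n <
        (reach (factorGraph Φ).skeleton (fun _ => True) (highVertices Φ D) t).card).card ≤
        t * Fintype.card (Formula k n m) := by
  classical
  induction t generalizing ε with
  | zero =>
    obtain ⟨D, hD⟩ := exists_nat_ge (κ / ε)
    refine ⟨D, fun n m hm => ?_⟩
    rw [Finset.filter_false_of_mem]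
    · simp
    · intro Φ _
      rw [not_lt]
      change ((highVertices Φ D).card : ℝ) ≤ _
      rw [highVertices, Finset.card_map]
      have h1 : (D * (Finset.univ.filter fun x => D < varDegree Φ x).card : ℝ) ≤ m * k := by
        exact_mod_cast mul_card_high_le Φ D
      have hD0 : (0 : ℝ) < D := (div_pos hκ hε).trans_le hD
      rw [div_le_iff₀ hε] at hD
      refine le_of_mul_le_mul_left (h1.trans (hm.trans ?_)) hD0
      rw [← mul_assoc]
      exact mul_le_mul_of_nonneg_right hD (Nat.cast_nonneg _)
  | succ t ih =>
    obtain ⟨D', hD'⟩ := exists_card_heavyDegree_le (k := k) hκ (half_pos hε)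
    have hc : (0 : ℝ) < 1 + k + D' := by positivity
    obtain ⟨D, hD⟩ := ih (ε := ε / 2 / (1 + k + D')) (by positivity)
    refine ⟨D, fun n m hm => ?_⟩
    have h1 := hD' n m hm
    have h2 := hD n m hm
    have h3 : (Finset.univ.filter fun Φ : Formula k n m => ε * n <
        (reach (factorGraph Φ).skeleton (fun _ => True) (highVertices Φ D) (t + 1)).card) ⊆
        (Finset.univ.filter fun Φ : Formula k n m => ε / 2 / (1 + k + D') * n <
        (reach (factorGraph Φ).skeleton (fun _ => True) (highVertices Φ D) t).card) ∪
        (Finset.univ.filter fun Φ : Formula k n m => ε / 2 * n < heavyDegree Φ D') := by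
      intro Φ hΦ
      replace hΦ := (Finset.mem_filter.1 hΦ).2
      simp only [Finset.mem_union, Finset.mem_filter, Finset.mem_univ, true_and]
      by_contra! hcon
      obtain ⟨h4, h5⟩ := hcon
      have h6 := card_reach_succ_le_heavyDegree Φ (fun _ => True) (highVertices Φ D) t D'
      have h7 : ((reach (factorGraph Φ).skeleton (fun _ => True)
          (highVertices Φ D) (t + 1)).card : ℝ) ≤ (1 + k + D') *
          (reach (factorGraph Φ).skeleton (fun _ => True) (highVertices Φ D) t).card +
          heavyDegree Φ D' := by exact_mod_cast h6
      have h8 := mul_le_mul_of_nonneg_left h4 hc.le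
      have h9 : (1 + k + D' : ℝ) * (ε / 2 / (1 + k + D') * n) = ε / 2 * n := by
        field_simp
      rw [h9] at h8
      linarith
    have h4 := (Finset.card_le_card h3).trans (Finset.card_union_le _ _)
    calc _ ≤ 2 ^ n * _ := Nat.mul_le_mul_left _ h4
      _ ≤ t * Fintype.card (Formula k n m) + Fintype.card (Formula k n m) := by
        rw [mul_add]
        exact add_le_add h2 h1
      _ = _ := by ring

end Degrees

/-! ### Concentration of the number of starting points of chains of low degree -/

section LowChains

variable {k n m : ℕ}

/-- A vertex of the factor graph is low if it is not a variable of degree more than `D`. -/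
def IsLow (Φ : Formula k n m) (D : ℕ) (a : FVertex n m) : Prop :=
  ∀ x, a = Sum.inl x → varDegree Φ x ≤ D

/-- A fresh walk of length `sL` from `v` through low vertices, which meets vertices with decreasing
processing times at the times `s, 2s, …, Ls`. -/
structure IsLowChain {s L : ℕ} (W D : ℕ) (Φ : Formula k n m) (ψ : FVertex n m → unitInterval)
    (p : Fin (s * L + 1) → FVertex n m) : Prop where
  fresh : IsFreshWalk (factorGraph Φ).skeleton W p
  low : ∀ i, IsLow Φ D (p i)
  anti : StrictAnti (ψ ∘ sampleWalk p)

open Classical in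
/-- The vertices from which a chain through low vertices starts. -/
noncomputable def chainStarts (s L W D : ℕ) (Φ : Formula k n m)
    (ψ : FVertex n m → unitInterval) : Finset (FVertex n m) :=
  Finset.univ.filter fun v => ∃ p : Fin (s * L + 1) → FVertex n m, p 0 = v ∧ IsLowChain W D Φ ψ p

theorem mem_chainStarts {s L W D : ℕ} {Φ : Formula k n m} {ψ : FVertex n m → unitInterval}
    {v : FVertex n m} : v ∈ chainStarts s L W D Φ ψ ↔
      ∃ p : Fin (s * L + 1) → FVertex n m, p 0 = v ∧ IsLowChain W D Φ ψ p := by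
  simp [chainStarts]

theorem card_reach_isLow_le (Φ : Formula k n m) (D : ℕ) {S : Finset (FVertex n m)}
    (hS : ∀ u ∈ S, IsLow Φ D u) (t : ℕ) :
    (reach (factorGraph Φ).skeleton (IsLow Φ D) S t).card ≤ (1 + k + D) ^ t * S.card := by
  classical
  induction t with
  | zero => rw [pow_zero, one_mul]; exact le_rfl
  | succ t ih =>
    set A := reach (factorGraph Φ).skeleton (IsLow Φ D) S t
    have h1 : ∀ a ∈ A, ((Finset.univ : Finset (FVertex n m)).filter
        ((factorGraph Φ).skeleton.Adj a)).card ≤ k + D := by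
      rintro (x | c) ha
      · refine (card_factorGraph_neighbors_inl_le Φ x).trans ?_
        have := forall_mem_reach hS t _ ha x rfl
        omega
      · refine (card_factorGraph_neighbors_inr_le Φ c).trans ?_
        omega
    calc _ ≤ A.card + ∑ a ∈ A, ((Finset.univ : Finset (FVertex n m)).filter
          ((factorGraph Φ).skeleton.Adj a)).card := card_reach_succ_le _ _ _ _
      _ ≤ A.card + ∑ a ∈ A, (k + D) := Nat.add_le_add_left (Finset.sum_le_sum h1) _
      _ = (1 + k + D) * A.card := by rw [Finset.sum_const, smul_eq_mul]; ring
      _ ≤ (1 + k + D) * ((1 + k + D) ^ t * S.card) := Nat.mul_le_mul_left _ ih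
      _ = _ := by ring

/-- If two inputs are such that every low chain for the first one which avoids `U` is also a low
chain for the second one, then passing to the second input loses few starting points of chains,
since low chains meeting `U` start close to `U` in a graph of bounded degree. -/
theorem card_chainStarts_le_add {s L W D : ℕ} {Φ Φ' : Formula k n m}
    {ψ ψ' : FVertex n m → unitInterval} (U : Finset (FVertex n m))
    (h : ∀ p : Fin (s * L + 1) → FVertex n m, (∀ i, p i ∉ U) →
      IsLowChain W D Φ ψ p → IsLowChain W D Φ' ψ' p) :
    (chainStarts s L W D Φ ψ).card ≤
      (chainStarts s L W D Φ' ψ').card + (1 + k + D) ^ (s * L) * U.card := by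
  classical
  have hsub : chainStarts s L W D Φ ψ ⊆ chainStarts s L W D Φ' ψ' ∪
      reach (factorGraph Φ).skeleton (IsLow Φ D) (U.filter (IsLow Φ D)) (s * L) := by
    intro v hv
    obtain ⟨p, rfl, hp⟩ := mem_chainStarts.1 hv
    rw [Finset.mem_union]
    by_cases hU : ∀ i, p i ∉ U
    · exact Or.inl (mem_chainStarts.2 ⟨p, rfl, h p hU hp⟩)
    · push Not at hU
      obtain ⟨i, hi⟩ := hU
      exact Or.inr (hp.fresh.mem_reach hp.low (Finset.mem_filter.2 ⟨hi, hp.low i⟩))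
  refine (Finset.card_le_card hsub).trans ((Finset.card_union_le _ _).trans ?_)
  refine Nat.add_le_add_left ((card_reach_isLow_le Φ D
    (fun u hu => (Finset.mem_filter.1 hu).2) _).trans ?_) _
  exact Nat.mul_le_mul_left _ (Finset.card_le_card (Finset.filter_subset _ _))

theorem card_chainStarts_update_clause_le {s L W D : ℕ} (Φ : Formula k n m)
    (ψ : FVertex n m → unitInterval) (c : Fin m) (C : Fin k → Fin n × Bool) :
    (chainStarts s L W D Φ ψ).card ≤ (chainStarts s L W D (Function.update Φ c C) ψ).card +
      (1 + k + D) ^ (s * L) * (k + 1) := by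
  classical
  let U : Finset (FVertex n m) := insert (Sum.inr c) (Finset.univ.image fun j => Sum.inl (C j).1)
  have hU : U.card ≤ k + 1 := by
    refine (Finset.card_insert_le _ _).trans (Nat.add_le_add_right ?_ 1)
    exact Finset.card_image_le.trans (by simp)
  have hUK := Nat.mul_le_mul_left ((1 + k + D) ^ (s * L)) hU
  suffices (chainStarts s L W D Φ ψ).card ≤
      (chainStarts s L W D (Function.update Φ c C) ψ).card + (1 + k + D) ^ (s * L) * U.card by
    omega
  refine card_chainStarts_le_add U fun p hpU hp => ⟨⟨fun i => ?_, hp.fresh.fresh⟩, ?_, hp.anti⟩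
  · have hc : ∀ i, p i ≠ Sum.inr c := fun i hi => hpU i (hi ▸ Finset.mem_insert_self _ _)
    refine (hp.fresh.step i).imp_right (factorGraph_adj_congr ?_)
    rintro d hd
    rw [Function.update_of_ne]
    rintro rfl
    exact hd.elim (hc _) (hc _)
  · intro i x hx
    refine le_trans (Finset.card_le_card fun e he => ?_) (hp.low i x hx)
    replace he := (Finset.mem_filter.1 he).2
    refine Finset.mem_filter.2 ⟨Finset.mem_univ _, ?_⟩
    by_cases hec : e.1 = c
    · exfalso
      rw [hec, Function.update_self] at he
      refine hpU i (Finset.mem_insert_of_mem (Finset.mem_image.2 ⟨e.2, Finset.mem_univ _, ?_⟩))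
      rw [hx, he]
    · rwa [Function.update_of_ne hec] at he

theorem card_chainStarts_update_time_le {s L W D : ℕ} (Φ : Formula k n m)
    (ψ : FVertex n m → unitInterval) (u : FVertex n m) (a : unitInterval) :
    (chainStarts s L W D Φ ψ).card ≤ (chainStarts s L W D Φ (Function.update ψ u a)).card +
      (1 + k + D) ^ (s * L) * (k + 1) := by
  refine (card_chainStarts_le_add {u} fun p hpU hp => ⟨hp.fresh, hp.low, ?_⟩).trans
    (Nat.add_le_add_left (Nat.mul_le_mul_left _ (by simp)) _)
  have : Function.update ψ u a ∘ sampleWalk p = ψ ∘ sampleWalk p := by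
    funext i
    exact Function.update_of_ne (fun h => hpU _ (Finset.mem_singleton.2 h)) _ _
  rw [this]
  exact hp.anti

theorem measurable_card_chainStarts (s L W D : ℕ) (Φ : Formula k n m) :
    Measurable fun ψ => ((chainStarts s L W D Φ ψ).card : ℝ) := by
  classical
  have h : (fun ψ => ((chainStarts s L W D Φ ψ).card : ℝ)) = fun ψ => ∑ v : FVertex n m,
      Set.indicator {ψ | v ∈ chainStarts s L W D Φ ψ} (fun _ => (1 : ℝ)) ψ := by
    funext ψ
    rw [← Finset.filter_univ_mem (chainStarts s L W D Φ ψ), Finset.card_filter]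
    push_cast
    refine Finset.sum_congr rfl fun v _ => ?_
    simp [Set.indicator_apply]
  rw [h]
  refine Finset.measurable_sum _ fun v _ => measurable_const.indicator ?_
  have : {ψ | v ∈ chainStarts s L W D Φ ψ} =
      ⋃ p ∈ {p : Fin (s * L + 1) → FVertex n m | p 0 = v ∧
        IsFreshWalk (factorGraph Φ).skeleton W p ∧ ∀ i, IsLow Φ D (p i)},
        {ψ | StrictAnti (ψ ∘ sampleWalk p)} := by
    ext ψ
    simp only [Set.mem_ofPred_eq, Set.mem_iUnion, mem_chainStarts]
    constructor
    · rintro ⟨p, h1, h2⟩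
      exact ⟨p, ⟨h1, h2.fresh, h2.low⟩, h2.anti⟩
    · rintro ⟨p, ⟨h1, h2, h3⟩, h4⟩
      exact ⟨p, h1, h2, h3, h4⟩
  rw [this]
  exact MeasurableSet.biUnion (Set.to_countable _) fun p _ =>
    measurableSet_strictAnti_comp (sampleWalk p)

open Classical in
/-- For a fixed formula, the expected number of starting points of chains is at most the number of
fresh walks over `L!`. -/
theorem integral_card_chainStarts_le (s L W D : ℕ) (Φ : Formula k n m) :
    ∫ ψ, ((chainStarts s L W D Φ ψ).card : ℝ) ∂(Measure.pi fun _ => volume) ≤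
      ((Finset.univ.filter fun p : Fin (s * L + 1) → FVertex n m =>
        Φ ∈ freshFormulas k W p).card : ℝ) / L.factorial := by
  set P := Finset.univ.filter fun p : Fin (s * L + 1) → FVertex n m => Φ ∈ freshFormulas k W p
  let π : Measure (FVertex n m → unitInterval) := Measure.pi fun _ => volume
  have hind : ∀ p : Fin (s * L + 1) → FVertex n m,
      Integrable (Set.indicator {ψ | StrictAnti (ψ ∘ sampleWalk p)} fun _ => (1 : ℝ)) π :=
    fun p => (integrable_const _).indicator (measurableSet_strictAnti_comp _)
  calc ∫ ψ, ((chainStarts s L W D Φ ψ).card : ℝ) ∂π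
      ≤ ∫ ψ, ∑ p ∈ P,
          Set.indicator {ψ | StrictAnti (ψ ∘ sampleWalk p)} (fun _ => (1 : ℝ)) ψ ∂π := by
        refine integral_mono (Integrable.of_bound
          (measurable_card_chainStarts s L W D Φ).aestronglyMeasurable
          (Fintype.card (FVertex n m)) (Filter.Eventually.of_forall fun ψ => ?_))
          (integrable_finsetSum _ fun p _ => hind p) fun ψ => ?_
        · rw [Real.norm_natCast]
          exact_mod_cast Finset.card_le_univ _
        · have h1 : chainStarts s L W D Φ ψ ⊆
              (P.filter fun p => StrictAnti (ψ ∘ sampleWalk p)).image fun p => p 0 := by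
            intro v hv
            obtain ⟨p, hp0, hp⟩ := mem_chainStarts.1 hv
            refine Finset.mem_image.2 ⟨p, Finset.mem_filter.2 ⟨Finset.mem_filter.2
              ⟨Finset.mem_univ _, mem_freshFormulas.2 hp.fresh⟩, hp.anti⟩, hp0⟩
          have h2 := (Finset.card_le_card h1).trans Finset.card_image_le
          rw [Finset.card_filter] at h2
          have h3 : ((chainStarts s L W D Φ ψ).card : ℝ) ≤
              ((∑ p ∈ P, if StrictAnti (ψ ∘ sampleWalk p) then 1 else 0 : ℕ) : ℝ) := by
            exact_mod_cast h2
          refine h3.trans_eq ?_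
          push_cast
          refine Finset.sum_congr rfl fun p _ => ?_
          simp [Set.indicator_apply]
    _ = ∑ p ∈ P, π.real {ψ | StrictAnti (ψ ∘ sampleWalk p)} := by
        rw [integral_finsetSum _ fun p _ => hind p]
        refine Finset.sum_congr rfl fun p _ => ?_
        rw [integral_indicator_const _ (measurableSet_strictAnti_comp _)]
        simp
    _ ≤ ∑ p ∈ P, 1 / (L.factorial : ℝ) := by
        refine Finset.sum_le_sum fun p _ => ?_
        have h := factorial_mul_strictAnti_le_one (volume : Measure unitInterval) (sampleWalk p)
        have h' := ENNReal.toReal_mono ENNReal.one_ne_top h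
        rw [ENNReal.toReal_mul, ENNReal.toReal_natCast, ENNReal.toReal_one] at h'
        rw [le_div_iff₀ (by positivity), mul_comm]
        exact h'
    _ = _ := by rw [Finset.sum_const, nsmul_eq_mul]; ring

instance isProbabilityMeasure_randomKSAT [NeZero n] : IsProbabilityMeasure (randomKSAT k n m) := by
  unfold randomKSAT
  exact ProbabilityTheory.isProbabilityMeasure_uniformOn Set.finite_univ Set.univ_nonempty

theorem randomKSAT_apply (S : Finset (Formula k n m)) :
    randomKSAT k n m S = (S.card : ENNReal) / Fintype.card (Formula k n m) := by
  rw [randomKSAT, ProbabilityTheory.uniformOn_univ, Measure.count_apply_finset]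

theorem randomKSAT_real_singleton (Φ : Formula k n m) :
    (randomKSAT k n m).real {Φ} = 1 / Fintype.card (Formula k n m) := by
  have := randomKSAT_apply {Φ}
  rw [Finset.coe_singleton] at this
  rw [Measure.real, this]
  simp

/-- The clauses of the random formula are independent. -/
theorem randomKSAT_eq_pi [NeZero n] : randomKSAT k n m =
    Measure.pi fun _ : Fin m =>
      (ProbabilityTheory.uniformOn Set.univ : Measure (Fin k → Fin n × Bool)) := by
  have : IsProbabilityMeasure
      (ProbabilityTheory.uniformOn Set.univ : Measure (Fin k → Fin n × Bool)) :=
    ProbabilityTheory.isProbabilityMeasure_uniformOn Set.finite_univ Set.univ_nonempty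
  refine Measure.ext_of_singleton fun Φ => ?_
  have h := randomKSAT_apply ({Φ} : Finset (Formula k n m))
  rw [Finset.coe_singleton] at h
  rw [h, Measure.pi_singleton]
  simp only [ProbabilityTheory.uniformOn_univ, Measure.count_singleton, Finset.prod_const,
    Finset.card_univ, Fintype.card_fin, Finset.card_singleton, Fintype.card_fun]
  rw [Nat.cast_one, one_div, one_div, ← ENNReal.inv_pow]
  push_cast
  rfl

theorem integral_prod_card_chainStarts_le [NeZero n] (s L W D : ℕ) :
    ∫ ω, ((chainStarts s L W D ω.1 ω.2).card : ℝ)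
      ∂((randomKSAT k n m).prod (Measure.pi fun _ => volume)) ≤
      (W + k + m * k / n) ^ (s * L) * (n + m) / L.factorial := by
  classical
  have hmeas : Measurable fun ω : Formula k n m × (FVertex n m → unitInterval) =>
      ((chainStarts s L W D ω.1 ω.2).card : ℝ) :=
    measurable_from_prod_countable_right fun Φ => measurable_card_chainStarts s L W D Φ
  have hn : (n : ℝ) ≠ 0 := by exact_mod_cast NeZero.ne n
  have hn' : (0 : ℝ) < n := by exact_mod_cast Nat.pos_of_ne_zero (NeZero.ne n)
  have hF : (0 : ℝ) < Fintype.card (Formula k n m) := by exact_mod_cast Fintype.card_pos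
  rw [integral_prod _ (Integrable.of_bound hmeas.aestronglyMeasurable
      (Fintype.card (FVertex n m)) (Filter.Eventually.of_forall fun ω => by
        rw [Real.norm_natCast]
        exact_mod_cast Finset.card_le_univ _)), integral_fintype (Integrable.of_finite)]
  simp only [randomKSAT_real_singleton, smul_eq_mul]
  have hcount : (n : ℝ) ^ (s * L) * ∑ Φ : Formula k n m,
      ((Finset.univ.filter fun p : Fin (s * L + 1) → FVertex n m =>
        Φ ∈ freshFormulas k W p).card : ℝ) ≤
      (n * W + n * k + m * k) ^ (s * L) * ((n + m) * Fintype.card (Formula k n m)) := by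
    have h := pow_mul_sum_card_freshFormulas_le (k := k) (n := n) (m := m) W (s * L)
    have h' : ∑ Φ : Formula k n m, (Finset.univ.filter fun p : Fin (s * L + 1) → FVertex n m =>
        Φ ∈ freshFormulas k W p).card =
        ∑ p : Fin (s * L + 1) → FVertex n m, (freshFormulas k W p).card := by
      simp only [Finset.card_filter]
      rw [Finset.sum_comm]
      refine Finset.sum_congr rfl fun p _ => ?_
      rw [← Finset.card_filter, Finset.filter_univ_mem]
    rw [← h'] at h
    exact_mod_cast h
  calc _ ≤ ∑ Φ : Formula k n m, 1 / (Fintype.card (Formula k n m) : ℝ) *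
        (((Finset.univ.filter fun p : Fin (s * L + 1) → FVertex n m =>
        Φ ∈ freshFormulas k W p).card : ℝ) / L.factorial) :=
        Finset.sum_le_sum fun Φ _ => mul_le_mul_of_nonneg_left
          (integral_card_chainStarts_le s L W D Φ) (by positivity)
    _ = (∑ Φ : Formula k n m, ((Finset.univ.filter fun p : Fin (s * L + 1) → FVertex n m =>
        Φ ∈ freshFormulas k W p).card : ℝ)) / (Fintype.card (Formula k n m) * L.factorial) := by
        rw [Finset.sum_div]
        refine Finset.sum_congr rfl fun Φ _ => ?_
        field_simp
    _ ≤ ((W + k + m * k / n) ^ (s * L) * ((n + m) * Fintype.card (Formula k n m))) /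
        (Fintype.card (Formula k n m) * L.factorial) := by
        refine div_le_div_of_nonneg_right ?_ (by positivity)
        refine le_of_mul_le_mul_left (hcount.trans_eq ?_) (pow_pos hn' (s * L))
        rw [← mul_assoc (_ ^ _) (_ ^ _), ← mul_pow]
        congr 2
        field_simp
    _ = _ := by field_simp

theorem abs_natCast_sub_le {a b K : ℕ} (h1 : a ≤ b + K) (h2 : b ≤ a + K) :
    |(a : ℝ) - b| ≤ K := by
  have h1' : (a : ℝ) ≤ b + K := by exact_mod_cast h1
  have h2' : (b : ℝ) ≤ a + K := by exact_mod_cast h2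
  exact abs_le.2 ⟨by linarith, by linarith⟩

/-- The number of starting points of low chains is concentrated about its mean. -/
theorem measure_card_chainStarts_ge_le [NeZero n] (s L W D : ℕ) {θ b E : ℝ} (hθ : 0 ≤ θ)
    (hE : ∫ ω, ((chainStarts s L W D ω.1 ω.2).card : ℝ)
      ∂((randomKSAT k n m).prod (Measure.pi fun _ => volume)) ≤ E) :
    ((randomKSAT k n m).prod (Measure.pi fun _ => volume))
      {ω | b ≤ ((chainStarts s L W D ω.1 ω.2).card : ℝ)} ≤
      ENNReal.ofReal (Real.exp (θ * E + (n + 2 * m) *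
        ((((1 + k + D) ^ (s * L) * (k + 1) : ℕ) : ℝ) ^ 2 * θ ^ 2 / 2) - θ * b)) := by
  classical
  set K := (1 + k + D) ^ (s * L) * (k + 1)
  let μ₀ : Measure (Fin k → Fin n × Bool) := ProbabilityTheory.uniformOn Set.univ
  have : IsProbabilityMeasure μ₀ :=
    ProbabilityTheory.isProbabilityMeasure_uniformOn Set.finite_univ Set.univ_nonempty
  have hmeas : Measurable fun ω : Formula k n m × (FVertex n m → unitInterval) =>
      ((chainStarts s L W D ω.1 ω.2).card : ℝ) :=
    measurable_from_prod_countable_right fun Φ => measurable_card_chainStarts s L W D Φ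
  have hM : ∀ ω : Formula k n m × (FVertex n m → unitInterval),
      |((chainStarts s L W D ω.1 ω.2).card : ℝ)| ≤ Fintype.card (FVertex n m) := by
    intro ω
    rw [Nat.abs_cast]
    exact_mod_cast Finset.card_le_univ _
  refine measure_ge_le_of_integral_exp_le hmeas hM hθ ?_
  have hsec : ∀ ψ, Integrable (fun Φ => ((chainStarts s L W D Φ ψ).card : ℝ))
      (randomKSAT k n m) := fun ψ => Integrable.of_finite
  have h := integral_exp_prod_le (μ := randomKSAT k n m)
    (ν := Measure.pi fun _ : FVertex n m => (volume : Measure unitInterval)) hmeas hM θ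
    (m * ((K : ℝ) ^ 2 * θ ^ 2 / 2)) ((n + m) * ((K : ℝ) ^ 2 * θ ^ 2 / 2))
    (fun ψ => by
      have := integral_exp_pi_le μ₀ (ι := Fin m)
        (f := fun Φ => ((chainStarts s L W D Φ ψ).card : ℝ)) (measurable_of_countable _)
        (fun Φ => hM (Φ, ψ)) (c := K) (fun Φ c C => by
          refine abs_natCast_sub_le ?_ (card_chainStarts_update_clause_le Φ ψ c C)
          have := card_chainStarts_update_clause_le (s := s) (L := L) (W := W) (D := D)
            (Function.update Φ c C) ψ c (Φ c)
          rwa [Function.update_idem, Function.update_eq_self] at this) θ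
      rw [Fintype.card_fin, ← randomKSAT_eq_pi] at this
      exact this)
    (by
      have := integral_exp_pi_le (volume : Measure unitInterval) (ι := FVertex n m)
        (f := fun ψ => ∫ Φ, ((chainStarts s L W D Φ ψ).card : ℝ) ∂(randomKSAT k n m))
        (hmeas.stronglyMeasurable.integral_prod_left').measurable
        (M := Fintype.card (FVertex n m)) (fun ψ => by
          have := norm_integral_le_of_norm_le_const (μ := randomKSAT k n m)
            (f := fun Φ => ((chainStarts s L W D Φ ψ).card : ℝ))
            (Filter.Eventually.of_forall fun Φ => hM (Φ, ψ))
          simpa using this) (c := K) (fun ψ u a => by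
          rw [← integral_sub (hsec _) (hsec _)]
          have := norm_integral_le_of_norm_le_const (μ := randomKSAT k n m)
            (f := fun Φ => ((chainStarts s L W D Φ (Function.update ψ u a)).card : ℝ) -
              (chainStarts s L W D Φ ψ).card) (C := K)
            (Filter.Eventually.of_forall fun Φ => by
              refine abs_natCast_sub_le ?_ (card_chainStarts_update_time_le Φ ψ u a)
              have := card_chainStarts_update_time_le (s := s) (L := L) (W := W) (D := D)
                Φ (Function.update ψ u a) u (ψ u)
              rwa [Function.update_idem, Function.update_eq_self] at this)
          simpa using this) θ
      rw [Fintype.card_sum, Fintype.card_fin, Fintype.card_fin, Nat.cast_add] at this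
      exact this)
  refine h.trans (Real.exp_le_exp.2 ?_)
  have := mul_le_mul_of_nonneg_left hE hθ
  linarith

end LowChains

/-! ### The exceptional event -/

section ExceptionalSet

variable {k n m : ℕ}

/-- Where a memory algorithm and its truncation disagree, either a variable of high degree is near,
or a low chain starts. -/
theorem hammingDist_run_truncation_le {r : ℕ} (A : LocalMemoryAlgorithm.{u} r) (L D : ℕ)
    (Φ : Formula k n m) (φ' : (A.truncation (2 * r * L + r)).Seed k n m)
    (hψ : Function.Injective (A.seedOfTruncation φ').2) :
    hammingDist (A.run Φ (A.seedOfTruncation φ')) ((A.truncation (2 * r * L + r)).run Φ φ') ≤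
      (reach (factorGraph Φ).skeleton (fun _ => True) (highVertices Φ D) ((2 * r + 1) * L)).card +
      (chainStarts (2 * r + 1) L (3 * (2 * r + 1)) D Φ (A.seedOfTruncation φ').2).card := by
  classical
  refine le_trans ?_ (Finset.card_union_le _ _)
  rw [hammingDist, ← Finset.card_map (⟨Sum.inl, Sum.inl_injective⟩ : Fin n ↪ FVertex n m)]
  refine Finset.card_le_card fun v hv => ?_
  obtain ⟨i, hi, rfl⟩ := Finset.mem_map.1 hv
  replace hi := (Finset.mem_filter.1 hi).2
  have hinfl : ¬ InfluenceSet (factorGraph Φ) r (A.seedOfTruncation φ').2 (Sum.inl i) ⊆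
      (factorGraph Φ).ball (2 * r * L) (Sum.inl i) := fun h =>
    hi (A.run_truncation le_rfl Φ φ' hψ i h)
  obtain ⟨p, hp0, hp, hanti⟩ := exists_isFreshWalk hinfl
  rw [Finset.mem_union]
  by_cases hlow : ∀ j, IsLow Φ D (p j)
  · exact Or.inr (mem_chainStarts.2 ⟨p, hp0, hp, hlow, hanti⟩)
  · left
    simp only [IsLow, not_forall, not_le] at hlow
    obtain ⟨j, x, hx, hD⟩ := hlow
    have := hp.mem_reach (P := fun _ => True) (fun _ => trivial) (S := highVertices Φ D) (i := j)
      (Finset.mem_map.2 ⟨x, Finset.mem_filter.2 ⟨Finset.mem_univ _, hD⟩, hx.symm⟩)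
    rwa [hp0] at this

theorem measurableSet_not_injective (V : Type*) [Finite V] :
    MeasurableSet {ψ : V → unitInterval | ¬ Function.Injective ψ} := by
  refine (measurableSet_setOfPred.2 ?_ : MeasurableSet {ψ : V → unitInterval |
    Function.Injective ψ}).compl
  refine Measurable.forall fun x => Measurable.forall fun y => Measurable.imp ?_ measurable_const
  exact measurableSet_setOfPred.1
    (measurableSet_eq_fun (measurable_pi_apply x) (measurable_pi_apply y))

/-- The exceptional event of the approximation: a tie between processing times, too many vertices
near variables of high degree, or too many starting points of low chains. -/
def exceptionalSet (s L W D : ℕ) (η : ℝ) (k n m : ℕ) :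
    Set (Formula k n m × (FVertex n m → unitInterval)) :=
  {ω | ¬ Function.Injective ω.2} ∪
  {ω | η / 4 * n < (reach (factorGraph ω.1).skeleton (fun _ => True) (highVertices ω.1 D)
    (s * L)).card} ∪
  {ω | η / 2 * n ≤ (chainStarts s L W D ω.1 ω.2).card}

theorem measurableSet_exceptionalSet (s L W D : ℕ) (η : ℝ) :
    MeasurableSet (exceptionalSet s L W D η k n m) := by
  refine MeasurableSet.union (MeasurableSet.union ?_ ?_) ?_
  · exact measurable_snd (measurableSet_not_injective (FVertex n m))
  · exact measurable_fst (Set.to_countable {Φ : Formula k n m | η / 4 * n <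
      (reach (factorGraph Φ).skeleton (fun _ => True) (highVertices Φ D)
        (s * L)).card}).measurableSet
  · exact measurableSet_le measurable_const
      (measurable_from_prod_countable_right fun Φ => measurable_card_chainStarts s L W D Φ)

theorem mem_exceptionalSet_of_le {r : ℕ} (A : LocalMemoryAlgorithm.{u} r) (L D : ℕ) {η : ℝ}
    (hη : 0 < η) (hn : 0 < n) (Φ : Formula k n m)
    (φ' : (A.truncation (2 * r * L + r)).Seed k n m)
    (h : η ≤ normalizedHamming (A.run Φ (A.seedOfTruncation φ'))
      ((A.truncation (2 * r * L + r)).run Φ φ')) :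
    (Φ, (A.seedOfTruncation φ').2) ∈
      exceptionalSet (2 * r + 1) L (3 * (2 * r + 1)) D η k n m := by
  by_contra hB
  simp only [exceptionalSet, Set.mem_union, Set.mem_ofPred_eq, not_or, not_not, not_lt,
    not_le] at hB
  obtain ⟨⟨h1, h2⟩, h3⟩ := hB
  have hn' : (0 : ℝ) < n := by exact_mod_cast hn
  have h4 := hammingDist_run_truncation_le A L D Φ φ' h1
  have h5 : (hammingDist (A.run Φ (A.seedOfTruncation φ'))
      ((A.truncation (2 * r * L + r)).run Φ φ') : ℝ) ≤
      (reach (factorGraph Φ).skeleton (fun _ => True) (highVertices Φ D)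
        ((2 * r + 1) * L)).card +
      (chainStarts (2 * r + 1) L (3 * (2 * r + 1)) D Φ (A.seedOfTruncation φ').2).card := by
    exact_mod_cast h4
  rw [normalizedHamming, le_div_iff₀ hn'] at h
  have h6 := mul_pos hη hn'
  linarith

theorem measure_exceptionalSet_le [NeZero n] {s L W D : ℕ} {η c : ℝ}
    (hreach : 2 ^ n * (Finset.univ.filter fun Φ : Formula k n m => η / 4 * n <
        (reach (factorGraph Φ).skeleton (fun _ => True) (highVertices Φ D) (s * L)).card).card ≤
        (s * L) * Fintype.card (Formula k n m))
    (hchain : ((randomKSAT k n m).prod (Measure.pi fun _ => volume))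
      {ω | η / 2 * n ≤ ((chainStarts s L W D ω.1 ω.2).card : ℝ)} ≤
      ENNReal.ofReal (Real.exp (-c * n))) :
    ((randomKSAT k n m).prod (Measure.pi fun _ => volume)) (exceptionalSet s L W D η k n m) ≤
      ENNReal.ofReal ((s * L) * Real.exp (-Real.log 2 * n) + Real.exp (-c * n)) := by
  classical
  have h1 : ((randomKSAT k n m).prod (Measure.pi fun _ => volume))
      {ω : Formula k n m × (FVertex n m → unitInterval) | ¬ Function.Injective ω.2} = 0 := by
    have := (measurePreserving_snd (μ := randomKSAT k n m)
      (ν := Measure.pi fun _ : FVertex n m => (volume : Measure unitInterval))).measure_preimage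
      (measurableSet_not_injective (FVertex n m)).nullMeasurableSet
    exact this.trans (ae_iff.1 (ae_injective_pi (V := FVertex n m) (volume : Measure unitInterval)))
  have h2 : ((randomKSAT k n m).prod (Measure.pi fun _ => volume))
      {ω : Formula k n m × (FVertex n m → unitInterval) | η / 4 * n <
        (reach (factorGraph ω.1).skeleton (fun _ => True) (highVertices ω.1 D) (s * L)).card} ≤
      ENNReal.ofReal ((s * L) * Real.exp (-Real.log 2 * n)) := by
    set S := Finset.univ.filter fun Φ : Formula k n m => η / 4 * n <
        (reach (factorGraph Φ).skeleton (fun _ => True) (highVertices Φ D) (s * L)).card with hS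
    have := (measurePreserving_fst (μ := randomKSAT k n m)
      (ν := Measure.pi fun _ : FVertex n m => (volume : Measure unitInterval))).measure_preimage
      (s := (S : Set (Formula k n m))) S.measurableSet.nullMeasurableSet
    have hset : {ω : Formula k n m × (FVertex n m → unitInterval) | η / 4 * n <
        (reach (factorGraph ω.1).skeleton (fun _ => True) (highVertices ω.1 D) (s * L)).card} =
        Prod.fst ⁻¹' (S : Set (Formula k n m)) := by
      ext ω
      simp [hS]
    rw [hset, this, randomKSAT_apply]
    have hF : (0 : ℝ) < Fintype.card (Formula k n m) := by exact_mod_cast Fintype.card_pos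
    rw [← ENNReal.ofReal_natCast, ← ENNReal.ofReal_natCast, ← ENNReal.ofReal_div_of_pos hF]
    refine ENNReal.ofReal_le_ofReal ?_
    have hexp : Real.exp (-Real.log 2 * n) = (2 ^ n)⁻¹ := by
      rw [neg_mul, Real.exp_neg, mul_comm, Real.exp_nat_mul, Real.exp_log two_pos]
    rw [hexp, div_le_iff₀ hF, mul_right_comm, ← div_eq_mul_inv, le_div_iff₀ (by positivity),
      mul_comm]
    exact_mod_cast hreach
  rw [ENNReal.ofReal_add (by positivity) (by positivity)]
  refine (measure_union_le _ _).trans (add_le_add ?_ hchain)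
  refine (measure_union_le _ _).trans ?_
  rw [h1, zero_add]
  exact h2

end ExceptionalSet

theorem proposition7p1 (k : ℕ) (α η : ℝ) (r : ℕ) (hαk : 2 ≤ α * k) (hk : 2 ≤ (k : ℝ) - 1)
    (hη : 0 < η) :
    ∃ (R : ℕ) (c : ℝ) (n₀ : ℕ), 0 < c ∧
      ∀ A : LocalMemoryAlgorithm.{u} r, ∃ A' : LocalAlgorithm.{u} R,
        ∀ n m : ℕ, n₀ ≤ n → m = ⌊α * n⌋₊ →
          ∃ γ : Measure (A.Seed k n m × A'.Seed k n m),
            IsCoupling γ (A.seedLaw k n m) (A'.seedLaw k n m) ∧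
            ((randomKSAT k n m).prod γ)
                {ω | η ≤ normalizedHamming (A.run ω.1 ω.2.1) (A'.run ω.1 ω.2.2)} ≤
              ENNReal.ofReal (Real.exp (-c * (n : ℝ) ^ (1 / 3 : ℝ))) := by
  have hk0 : (0 : ℝ) < k := by linarith
  have hα : 0 < α := by
    by_contra! hle
    have := mul_nonpos_of_nonpos_of_nonneg hle hk0.le
    linarith
  set s := 2 * r + 1 with hs
  set W := 3 * s with hW
  set C : ℝ := W + k + α * k with hC
  -- The factorial beats the exponential growth of the number of walks.
  obtain ⟨L, hL⟩ : ∃ L : ℕ, (C ^ s) ^ L / L.factorial * (1 + α) ≤ η / 4 := by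
    have h := (FloorSemiring.tendsto_pow_div_factorial_atTop (C ^ s)).mul_const (1 + α)
    rw [zero_mul] at h
    exact ((h.eventually_lt_const (by positivity : (0 : ℝ) < η / 4)).exists).imp fun _ h => h.le
  -- The truncation level for the degrees depends on the length of the walks.
  obtain ⟨D, hD⟩ := exists_card_reach_highVertices_le (k := k) (κ := α * k) (by linarith) (s * L)
    (ε := η / 4) (by positivity)
  set K : ℝ := (((1 + k + D) ^ (s * L) * (k + 1) : ℕ) : ℝ) with hK
  have hK0 : 0 < K := by
    rw [hK]
    exact_mod_cast (by positivity : 0 < (1 + k + D) ^ (s * L) * (k + 1))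
  -- This value of `θ` optimizes the exponential moment bound.
  set θ : ℝ := η / (4 * (1 + 2 * α) * K ^ 2) with hθ
  have hθ0 : 0 < θ := by positivity
  set c₁ : ℝ := θ * η / 8 with hc₁
  have hc₁0 : 0 < c₁ := by positivity
  set c₂ : ℝ := min c₁ (Real.log 2) with hc₂
  have hc₂0 : 0 < c₂ := lt_min hc₁0 (Real.log_pos one_lt_two)
  obtain ⟨n₁, hn₁⟩ := exists_nat_ge (2 * (s * L + 1) / c₂)
  refine ⟨2 * r * L + r, c₂ / 2, n₁ + 1, by positivity, fun A => ⟨A.truncation _, ?_⟩⟩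
  intro n m hn hm
  have hn0 : 0 < n := by omega
  have : NeZero n := ⟨hn0.ne'⟩
  have hn' : (1 : ℝ) ≤ n := by exact_mod_cast hn0
  have hmα : (m : ℝ) ≤ α * n := by
    rw [hm]
    exact Nat.floor_le (by positivity)
  refine ⟨A.seedCoupling _ k n m, A.isCoupling_seedCoupling _, ?_⟩
  refine (A.prod_seedCoupling_le (measurableSet_exceptionalSet s L W D η)
    (fun Φ φ' h => mem_exceptionalSet_of_le A L D hη hn0 Φ φ' h) _).trans ?_
  have hE := integral_prod_card_chainStarts_le (k := k) (n := n) (m := m) s L W D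
  have hE' : ((W : ℝ) + k + m * k / n) ^ (s * L) * (n + m) / L.factorial ≤ η / 4 * n := by
    have h1 : (W : ℝ) + k + m * k / n ≤ C := by
      rw [hC, add_le_add_iff_left, div_le_iff₀ (by linarith)]
      calc (m * k : ℝ) ≤ α * n * k := mul_le_mul_of_nonneg_right hmα hk0.le
        _ = α * k * n := by ring
    calc ((W : ℝ) + k + m * k / n) ^ (s * L) * (n + m) / L.factorial
        ≤ C ^ (s * L) * (n + α * n) / L.factorial := by gcongr
      _ = (C ^ s) ^ L / L.factorial * (1 + α) * n := by rw [pow_mul]; ring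
      _ ≤ η / 4 * n := mul_le_mul_of_nonneg_right hL (by linarith)
  have hchain := measure_card_chainStarts_ge_le (k := k) (n := n) (m := m) s L W D
    (θ := θ) (b := η / 2 * n) hθ0.le (hE.trans hE')
  have hexp : θ * (η / 4 * n) + (n + 2 * m) * (K ^ 2 * θ ^ 2 / 2) - θ * (η / 2 * n) ≤
      -c₁ * n := by
    have h1 : ((n : ℝ) + 2 * m) * (K ^ 2 * θ ^ 2 / 2) ≤
        ((1 + 2 * α) * n) * (K ^ 2 * θ ^ 2 / 2) :=
      mul_le_mul_of_nonneg_right (by linarith) (by positivity)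
    have h2 : ((1 + 2 * α) * n) * (K ^ 2 * θ ^ 2 / 2) = θ * η / 8 * n := by
      have : (1 + 2 * α) * K ^ 2 * θ = η / 4 := by
        rw [hθ]
        field_simp
      calc ((1 + 2 * α) * n) * (K ^ 2 * θ ^ 2 / 2) =
          ((1 + 2 * α) * K ^ 2 * θ) * θ * n / 2 := by ring
        _ = _ := by rw [this]; ring
    rw [hc₁]
    linarith
  have hmk : (m * k : ℝ) ≤ α * k * n := by
    calc (m * k : ℝ) ≤ α * n * k := mul_le_mul_of_nonneg_right hmα hk0.le
      _ = α * k * n := by ring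
  refine (measure_exceptionalSet_le (c := c₁) (by exact_mod_cast hD n m hmk)
    (hchain.trans (ENNReal.ofReal_le_ofReal (Real.exp_le_exp.2 hexp)))).trans ?_
  refine ENNReal.ofReal_le_ofReal ?_
  have h1 : Real.exp (-Real.log 2 * n) ≤ Real.exp (-c₂ * n) :=
    Real.exp_le_exp.2 (mul_le_mul_of_nonneg_right (neg_le_neg (min_le_right _ _)) (by linarith))
  have h2 : Real.exp (-c₁ * n) ≤ Real.exp (-c₂ * n) :=
    Real.exp_le_exp.2 (mul_le_mul_of_nonneg_right (neg_le_neg (min_le_left _ _)) (by linarith))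
  have h3 : ((s * L : ℝ) + 1) ≤ Real.exp (c₂ / 2 * n) := by
    have h4 : (n₁ : ℝ) ≤ n := by exact_mod_cast (by omega : n₁ ≤ n)
    have h5 := hn₁.trans h4
    rw [div_le_iff₀ hc₂0] at h5
    have h6 := Real.add_one_le_exp (c₂ / 2 * n)
    linarith
  have h4 : (n : ℝ) ^ (1 / 3 : ℝ) ≤ n := by
    calc (n : ℝ) ^ (1 / 3 : ℝ) ≤ (n : ℝ) ^ (1 : ℝ) :=
          Real.rpow_le_rpow_of_exponent_le hn' (by norm_num)
      _ = n := Real.rpow_one _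
  calc (s * L : ℝ) * Real.exp (-Real.log 2 * n) + Real.exp (-c₁ * n)
      ≤ (s * L : ℝ) * Real.exp (-c₂ * n) + Real.exp (-c₂ * n) :=
        add_le_add (mul_le_mul_of_nonneg_left h1 (by positivity)) h2
    _ = (s * L + 1) * Real.exp (-c₂ * n) := by ring
    _ ≤ Real.exp (c₂ / 2 * n) * Real.exp (-c₂ * n) :=
        mul_le_mul_of_nonneg_right h3 (Real.exp_nonneg _)
    _ = Real.exp (-(c₂ / 2) * n) := by rw [← Real.exp_add]; congr 1; ring
    _ ≤ _ := Real.exp_le_exp.2 (mul_le_mul_of_nonpos_left h4 (by linarith))
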